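/- Let $0<p<q$ with $p+q=1$. **Walk.** Consider the random walk on $\mathbb Z$ with independent steps equal to $k-3$ with probability $\binom6k p^kq^{6-k}$, $0\le k\le 6$. For $j\in\mathbb Z\setminus\{0\}$ let $\nu_j$ be the probability that the walk started at $-j$ ever hits $0$, and let $\nu_0$ be the probability that the walk started at $0$ returns to $0$ at some later time. **Chain.** Let $U,V$ be the transition matrices on $\{0,1,2,\dots\}$ with $U_{i,i+1}=p$, $U_{i,i}=q$; $V_{0,0}=1$, and $V_{i,i-1}=q$, $V_{i,i}=p$ for $i\ge1$ (all other entries $0$). **Notation.** Put $\theta=\sqrt{1+4pq+16p^2q^2}$, $\Delta=1-256p^3q^3=1-256p^3+768p^4-768p^5+256p^6$, $$u=1-2p+6p^2-8p^3+4p^4,\qquad v=1+6p^2-28p^3+54p^4-48p^5+16p^6,$$ $$B=(q-p)u+(q-p)^3\theta+\sqrt2\,(q-p)^2\sqrt{v+u\theta},\qquad A(p)=\frac{B}{12q^6}.$$ Then the following hold. (1) If $256p^3q^3\ne1$ (otherwise the formulas below have zero denominator), then $$\nu_0=\frac{N_0}{\Delta},\quad \nu_{-1}=\frac{N_1}{2p^2\Delta},\quad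 \nu_{-2}=\frac{N_2}{2p^4\Delta},\quad \nu_{-3}=\frac{N_3}{2p^6\Delta},\quad \nu_1=\frac{N_1}{2q^2\Delta},\quad \nu_2=\frac{N_2}{2q^4\Delta},$$ where $$\begin{aligned}N_0={}&-2p(-3-18p+92p^2-120p^3+816p^4-2816p^5+3840p^6-2304p^7+512p^8)\\&+2(q-p)^3(1+4p+12p^2-32p^3+16p^4)\theta-(q-p)^2\theta\sqrt2\sqrt{R_0},\\ N_1={}&-6pq-(q-p)^2(1+32p^2-64p^3+32p^4)\theta+(q-p)\theta\sqrt{R_1},\\ N_2={}&-6p^2q^2(5-256p^3+768p^4-768p^5+256p^6)-(q-p)^4(1+8p+24p^2-64p^3+32p^4)\theta+(q-p)\theta\sqrt{R_2},\\ N_3={}&-2p(-3-18p-33p^2+255p^3+441p^4-643p^5-8448p^6+28416p^7-40448p^8+30720p^9-12288p^{10}+2048p^{11})\\&-(q-p)^2(-2-10p-41p^2+190p^3+89p^4-1088p^5+1728p^6-1152p^7+288p^8)\theta-(q-p)\theta\sqrt{R_3},\end{aligned}$$ $$\begin{aligned}R_0={}&(-1-8p+8p^2)(-1-2p-46p^2-32p^3+848p^4-2432p^5+3200p^6-2048p^7+512p^8)\\&+(1+8p+88p^2-448p^3+1888p^4-4864p^5+6400p^6-4096p^7+1024p^8)\theta,\\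 R_1={}&(q-p)^2(-1-8p+8p^2)(1-8p-56p^2-128p^3+704p^4-768p^5+256p^6)\\&+2(1-32p^2+64p^3+992p^4-4096p^5+6144p^6-4096p^7+1024p^8)\theta,\\ R_2={}&-1+8p+8p^2+288p^3-944p^4-3136p^5+3776p^6-73728p^7+712704p^8-2445312p^9\\&+4345856p^{10}-4489216p^{11}+2736128p^{12}-917504p^{13}+131072p^{14}\\&+2(1+4p+12p^2-32p^3+16p^4)(1-8p+40p^2-320p^3+1824p^4-4864p^5+6400p^6-4096p^7+1024p^8)\theta,\\ R_3={}&2+24p+186p^2+272p^3-1239p^4-8796p^5+43998p^6-51924p^7-581577p^8+3019604p^9-4358340p^{10}\\&-6991872p^{11}+38416256p^{12}-72366336p^{13}+79163136p^{14}-54779904p^{15}+23804928p^{16}-5971968p^{17}+663552p^{18}\\&+2(1+10p+69p^2-18p^3-330p^4-3840p^5+8160p^6+62940p^7-250095p^8+56320p^9+1459360p^{10}\\&\quad-4044096p^{11}+5577696p^{12}-4608000p^{13}+2322432p^{14}-663552p^{15}+82944p^{16})\theta.\end{aligned}$$ (2) The chain with transition matrix $U^3V^3$ has a unique stationary distribution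 $(\pi_j)_{j\ge0}$, and $\pi_j\sim A(p)\,(p^2/q^2)^j$ as $j\to\infty$. (3) For every $j\ge0$ the linear system $$\begin{aligned}\lambda_0+\lambda_{-1}\nu_{-1}+\lambda_{-2}\nu_{-2}&=(1-\nu_0)\pi_j,\\ \lambda_0\nu_1+\lambda_{-1}+\lambda_{-2}\nu_{-1}&=(1-\nu_0)\pi_{j+1},\\ \lambda_0\nu_2+\lambda_{-1}\nu_1+\lambda_{-2}&=(1-\nu_0)\pi_{j+2}\end{aligned}$$ has a unique solution. Let $\lambda=\lambda^{(j)}=\lambda_0+\lambda_{-1}+\lambda_{-2}$; this is the rate of clumps of visits to $\Omega=\{0,-1,-2\}$, the origin being placed at level $j$. As $j\to\infty$, $$\lambda\sim\frac{B}{4q^4}\,\pi_j,\qquad\text{and the hidden relation}\qquad \lim_{j\to\infty}\frac{\lambda}{\pi_j}=3q^2A(p)\qquad\text{holds.}$$ (4) Consequently the exponential coefficient $\varepsilon_1:=\lim_{j\to\infty}\frac16\cdot\frac{p^2}{q^2}\cdot\frac{q^3}{p^3}\cdot\frac{\lambda}{\pi_j}\cdot A(p)$ exists and $$\varepsilon_1=\frac{B^2}{288\,p\,q^9}=\frac{\chi_3(p)}6,\qquad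 \chi_3(p)=\frac{(q-p)^2}{12pq^9}\Bigl[\alpha+(q-p)^2\beta\theta+(q-p)\sqrt2\sqrt{\gamma+\alpha\beta\theta}\Bigr],$$ where $$\begin{aligned}\alpha&=1-4p+10p^2-52p^3+226p^4-520p^5+640p^6-400p^7+100p^8,\\ \beta&=1-2p+6p^2-8p^3+4p^4,\\ \gamma&=1-4p+16p^2-104p^3+506p^4-1808p^5+5604p^6-15576p^7+35574p^8\\&\quad-61160p^9+75152p^{10}-63440p^{11}+34840p^{12}-11200p^{13}+1600p^{14}.\end{aligned}$$ -/

import Mathlib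

namespace TrafficLight

noncomputable section

/-! ### The random walk on the integers and its hitting probabilities -/

/-- The law of one step: a binomial variable with `6` trials and success probability `p`,
shifted by `-3`; that is, the step equals `k - 3` with probability `C(6,k) p ^ k (1-p) ^ (6-k)`. -/
def stepLaw (p : unitInterval) : MeasureTheory.Measure ℤ :=
  (ProbabilityTheory.binomial 6 p).map (fun k : ℕ => (k : ℤ) - 3)

/-- The law of an infinite sequence of independent steps, each with law `stepLaw p`. -/
def stepsLaw (p : unitInterval) : MeasureTheory.Measure (ℕ → ℤ) :=
  MeasureTheory.Measure.infinitePi (fun _ : ℕ => stepLaw p)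

/-- The position after `n` steps of the walk started at `x` with step sequence `ω`. -/
def position (x : ℤ) (ω : ℕ → ℤ) (n : ℕ) : ℤ :=
  x + ∑ i ∈ Finset.range n, ω i

/-- `nu p j` is the probability that the walk started at `-j` is at `0` at some time `n ≥ 1`.
For `j ≠ 0` this is the probability that the walk eventually hits `0`; for `j = 0` it is the
probability that the walk returns to its starting point. -/
def nu (p : unitInterval) (j : ℤ) : ℝ :=
  (stepsLaw p).real {ω | ∃ n : ℕ, 1 ≤ n ∧ position (-j) ω n = 0}

/-! ### The queue observed at times divisible by six, and its stationary distribution -/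

/-- Product of infinite matrices. It is only used for matrices whose rows have finite support,
so that every sum is finite. -/
def infMul (A B : Matrix ℕ ℕ ℝ) : Matrix ℕ ℕ ℝ :=
  fun i k => ∑' j, A i j * B j k

/-- Transition matrix `U` of one red time unit: a car arrives with probability `p`. -/
def redMatrix (p : ℝ) : Matrix ℕ ℕ ℝ :=
  fun i k => if k = i + 1 then p else if k = i then 1 - p else 0

/-- Transition matrix `V` of one green time unit: the state `0` is kept; from a state `i ≥ 1` the
queue decreases by one with probability `1 - p` and stays the same with probability `p`. -/
def greenMatrix (p : ℝ) : Matrix ℕ ℕ ℝ :=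
  fun i k =>
    if i = 0 then (if k = 0 then 1 else 0)
    else if k + 1 = i then 1 - p else if k = i then p else 0

/-- The transition matrix `U ^ 3 * V ^ 3` of the queue length at times divisible by six. -/
def cycleMatrix (p : ℝ) : Matrix ℕ ℕ ℝ :=
  infMul (redMatrix p) (infMul (redMatrix p) (infMul (redMatrix p)
    (infMul (greenMatrix p) (infMul (greenMatrix p) (greenMatrix p)))))

/-- `π` is a stationary probability distribution of the chain with matrix `U ^ 3 * V ^ 3`. -/
structure IsStationary (p : ℝ) (π : ℕ → ℝ) : Prop where
  nonneg : ∀ j, 0 ≤ π j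
  hasSum_one : HasSum π 1
  invariant : ∀ k, HasSum (fun j => π j * cycleMatrix p j k) (π k)

/-! ### The clump rate -/

/-- The linear system for the rates `l 0`, `l 1`, `l 2` of clumps of visits to `{0, -1, -2}`
that start at `0`, `-1`, `-2` respectively, the origin being placed at the level `j`. -/
def IsClumpRates (p : unitInterval) (π : ℕ → ℝ) (j : ℕ) (l : Fin 3 → ℝ) : Prop :=
  l 0 + l 1 * nu p (-1) + l 2 * nu p (-2) = (1 - nu p 0) * π j ∧
  l 0 * nu p 1 + l 1 + l 2 * nu p (-1) = (1 - nu p 0) * π (j + 1) ∧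
  l 0 * nu p 2 + l 1 * nu p 1 + l 2 = (1 - nu p 0) * π (j + 2)

/-- The total clump rate. -/
def clumpRate (l : Fin 3 → ℝ) : ℝ := l 0 + l 1 + l 2

/-! ### Closed forms -/

def theta (p : ℝ) : ℝ :=
  Real.sqrt (1 + 4 * p * (1 - p) + 16 * p ^ 2 * (1 - p) ^ 2)

def uPoly (p : ℝ) : ℝ := 1 - 2 * p + 6 * p ^ 2 - 8 * p ^ 3 + 4 * p ^ 4

def vPoly (p : ℝ) : ℝ :=
  1 + 6 * p ^ 2 - 28 * p ^ 3 + 54 * p ^ 4 - 48 * p ^ 5 + 16 * p ^ 6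

/-- The bracket `(q-p) u + (q-p)^3 θ + √2 (q-p)^2 √(v + u θ)`. -/
def bracket (p : ℝ) : ℝ :=
  let q := 1 - p;
  (q - p) * uPoly p + (q - p) ^ 3 * theta p
    + Real.sqrt 2 * (q - p) ^ 2 * Real.sqrt (vPoly p + uPoly p * theta p)

/-- The constant `A(p)`. -/
def tailConst (p : ℝ) : ℝ := bracket p / (12 * (1 - p) ^ 6)

/-- The common factor `1 - 256 p^3 q^3` of the denominators of the hitting probabilities. -/
def hitDen (p : ℝ) : ℝ :=
  1 - 256 * p ^ 3 + 768 * p ^ 4 - 768 * p ^ 5 + 256 * p ^ 6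

def hitRadicand0 (p : ℝ) : ℝ :=
  (-1 - 8 * p + 8 * p ^ 2) *
      (-1 - 2 * p - 46 * p ^ 2 - 32 * p ^ 3 + 848 * p ^ 4 - 2432 * p ^ 5 + 3200 * p ^ 6
        - 2048 * p ^ 7 + 512 * p ^ 8)
    + (1 + 8 * p + 88 * p ^ 2 - 448 * p ^ 3 + 1888 * p ^ 4 - 4864 * p ^ 5 + 6400 * p ^ 6
        - 4096 * p ^ 7 + 1024 * p ^ 8) * theta p

/-- Numerator of the closed form of the return probability `ν₀`. -/
def hitNum0 (p : ℝ) : ℝ :=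
  let q := 1 - p;
  -2 * p * (-3 - 18 * p + 92 * p ^ 2 - 120 * p ^ 3 + 816 * p ^ 4 - 2816 * p ^ 5 + 3840 * p ^ 6
      - 2304 * p ^ 7 + 512 * p ^ 8)
    + 2 * (q - p) ^ 3 * (1 + 4 * p + 12 * p ^ 2 - 32 * p ^ 3 + 16 * p ^ 4) * theta p
    - (q - p) ^ 2 * theta p * Real.sqrt 2 * Real.sqrt (hitRadicand0 p)

def hitRadicand1 (p : ℝ) : ℝ :=
  let q := 1 - p;
  (q - p) ^ 2 * (-1 - 8 * p + 8 * p ^ 2) *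
      (1 - 8 * p - 56 * p ^ 2 - 128 * p ^ 3 + 704 * p ^ 4 - 768 * p ^ 5 + 256 * p ^ 6)
    + 2 * (1 - 32 * p ^ 2 + 64 * p ^ 3 + 992 * p ^ 4 - 4096 * p ^ 5 + 6144 * p ^ 6
        - 4096 * p ^ 7 + 1024 * p ^ 8) * theta p

/-- Common numerator of the closed forms of `ν₁` and `ν₋₁`. -/
def hitNum1 (p : ℝ) : ℝ :=
  let q := 1 - p;
  -6 * p * q - (q - p) ^ 2 * (1 + 32 * p ^ 2 - 64 * p ^ 3 + 32 * p ^ 4) * theta p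
    + (q - p) * theta p * Real.sqrt (hitRadicand1 p)

def hitRadicand2 (p : ℝ) : ℝ :=
  (-1 + 8 * p + 8 * p ^ 2 + 288 * p ^ 3 - 944 * p ^ 4 - 3136 * p ^ 5 + 3776 * p ^ 6
      - 73728 * p ^ 7 + 712704 * p ^ 8 - 2445312 * p ^ 9 + 4345856 * p ^ 10 - 4489216 * p ^ 11
      + 2736128 * p ^ 12 - 917504 * p ^ 13 + 131072 * p ^ 14)
    + 2 * (1 + 4 * p + 12 * p ^ 2 - 32 * p ^ 3 + 16 * p ^ 4) *
      (1 - 8 * p + 40 * p ^ 2 - 320 * p ^ 3 + 1824 * p ^ 4 - 4864 * p ^ 5 + 6400 * p ^ 6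
        - 4096 * p ^ 7 + 1024 * p ^ 8) * theta p

/-- Common numerator of the closed forms of `ν₂` and `ν₋₂`. -/
def hitNum2 (p : ℝ) : ℝ :=
  let q := 1 - p;
  -6 * p ^ 2 * q ^ 2 * (5 - 256 * p ^ 3 + 768 * p ^ 4 - 768 * p ^ 5 + 256 * p ^ 6)
    - (q - p) ^ 4 * (1 + 8 * p + 24 * p ^ 2 - 64 * p ^ 3 + 32 * p ^ 4) * theta p
    + (q - p) * theta p * Real.sqrt (hitRadicand2 p)

def hitRadicand3 (p : ℝ) : ℝ :=
  (2 + 24 * p + 186 * p ^ 2 + 272 * p ^ 3 - 1239 * p ^ 4 - 8796 * p ^ 5 + 43998 * p ^ 6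
      - 51924 * p ^ 7 - 581577 * p ^ 8 + 3019604 * p ^ 9 - 4358340 * p ^ 10 - 6991872 * p ^ 11
      + 38416256 * p ^ 12 - 72366336 * p ^ 13 + 79163136 * p ^ 14 - 54779904 * p ^ 15
      + 23804928 * p ^ 16 - 5971968 * p ^ 17 + 663552 * p ^ 18)
    + 2 * (1 + 10 * p + 69 * p ^ 2 - 18 * p ^ 3 - 330 * p ^ 4 - 3840 * p ^ 5 + 8160 * p ^ 6
      + 62940 * p ^ 7 - 250095 * p ^ 8 + 56320 * p ^ 9 + 1459360 * p ^ 10 - 4044096 * p ^ 11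
      + 5577696 * p ^ 12 - 4608000 * p ^ 13 + 2322432 * p ^ 14 - 663552 * p ^ 15
      + 82944 * p ^ 16) * theta p

/-- Numerator of the closed form of `ν₋₃`. -/
def hitNum3 (p : ℝ) : ℝ :=
  let q := 1 - p;
  -2 * p * (-3 - 18 * p - 33 * p ^ 2 + 255 * p ^ 3 + 441 * p ^ 4 - 643 * p ^ 5 - 8448 * p ^ 6
      + 28416 * p ^ 7 - 40448 * p ^ 8 + 30720 * p ^ 9 - 12288 * p ^ 10 + 2048 * p ^ 11)
    - (q - p) ^ 2 * (-2 - 10 * p - 41 * p ^ 2 + 190 * p ^ 3 + 89 * p ^ 4 - 1088 * p ^ 5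
      + 1728 * p ^ 6 - 1152 * p ^ 7 + 288 * p ^ 8) * theta p
    - (q - p) * theta p * Real.sqrt (hitRadicand3 p)

def alphaPoly (p : ℝ) : ℝ :=
  1 - 4 * p + 10 * p ^ 2 - 52 * p ^ 3 + 226 * p ^ 4 - 520 * p ^ 5 + 640 * p ^ 6 - 400 * p ^ 7
    + 100 * p ^ 8

def betaPoly (p : ℝ) : ℝ := 1 - 2 * p + 6 * p ^ 2 - 8 * p ^ 3 + 4 * p ^ 4

def gammaPoly (p : ℝ) : ℝ :=
  1 - 4 * p + 16 * p ^ 2 - 104 * p ^ 3 + 506 * p ^ 4 - 1808 * p ^ 5 + 5604 * p ^ 6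
    - 15576 * p ^ 7 + 35574 * p ^ 8 - 61160 * p ^ 9 + 75152 * p ^ 10 - 63440 * p ^ 11
    + 34840 * p ^ 12 - 11200 * p ^ 13 + 1600 * p ^ 14

/-- The previously conjectured expression `χ₃(p)`. -/
def chi3 (p : ℝ) : ℝ :=
  let q := 1 - p;
  (q - p) ^ 2 / (12 * p * q ^ 9) *
    (alphaPoly p + (q - p) ^ 2 * betaPoly p * theta p
      + (q - p) * Real.sqrt 2 * Real.sqrt (gammaPoly p + alphaPoly p * betaPoly p * theta p))

end

end TrafficLight

open MeasureTheory ProbabilityTheory Filter Topology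

namespace TrafficLight

/-! Hitting probabilities. Splitting the hitting event at the last visit to j gives ν_j = (G_j −
δ_{j0})(1 − ν_0), with G the Green function (`nu_of_green`). After tilting by (p/q)^j, one step of
the walk becomes T³, where T is convolution with the weights pq·(1, 2, 1). The partial fraction 1/(1
− T³) = (1/3) Σ 1/(1 − ωT) over the cube roots of unity ω then reduces G to three explicit kernels
ρ^|j| / s with s² = 1 − 4ωpq (`kernel_eq`, `average_eq`, `tendsto_sum_conv`).

Stationary distribution. At positive states invariance is a linear recurrence with characteristic
equation (p + qX)⁶ = X³, which splits over the same cube roots of unity into three quadratics. Each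
has one root inside the unit disc and one of modulus at least 1, so a null solution involves only
the three decaying roots. The barrier at 0 becomes two zero initial values, leaving a
one-dimensional space, and the total mass fixes the multiple. Conservation of mass supplies the
equation at 0 and shows that |π| is again invariant, which forces π ≥ 0 (`exists_stationary`). The
dominant root is (p/q)².

Clump rates. Multiplied by G_0 = 1/(1 − ν_0), the system is a tilted symmetric Toeplitz system in
G_0, G_1, G_2, solved by parity (`toeplitz_iff`). The limit of λ/π_j follows from π_{j+i}/π_j →
(p/q)^{2i}.

Closed forms. Let a and c be the real part and √3 times the absolute imaginary part of the nonreal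
roots s. The nested radicals in the statement are linear forms in a and c, up to a factor √2 or a
factor in θ, so everything reduces to polynomial identities modulo `RootRelations`. The hidden
relation holds because `bracket_mul_one` and `bracket_mul_two` express the tail constant and the
clump limit through the same bracket B. -/

/-! ### The path measure and its first step. -/

/-- Put a first step in front of a sequence of steps. -/
def consStep (x : ℤ) (ω : ℕ → ℤ) : ℕ → ℤ
  | 0 => x
  | n + 1 => ω n

lemma measurable_consStep : Measurable (fun z : ℤ × (ℕ → ℤ) => consStep z.1 z.2) := by
  refine measurable_pi_lambda _ fun n => ?_
  cases n with
  | zero => exact measurable_fst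
  | succ n => exact (measurable_pi_apply n).comp measurable_snd

instance (p : unitInterval) : IsProbabilityMeasure (stepLaw p) :=
  Measure.isProbabilityMeasure_map .of_discrete

instance (p : unitInterval) : IsProbabilityMeasure (stepsLaw p) := by
  unfold stepsLaw; infer_instance

/-- An infinite product measure is determined by its values on finite boxes, and on a box over an
initial segment of indices prepending a step splits off one factor. -/
lemma map_consStep (p : unitInterval) :
    ((stepLaw p).prod (stepsLaw p)).map (fun z => consStep z.1 z.2) = stepsLaw p := by
  refine Measure.eq_infinitePi _ fun s t ht => ?_
  classical
  obtain ⟨N, hN⟩ := s.exists_nat_subset_range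
  -- Filling up with the whole space extends the box to the indices 0, …, N; the length N + 1
  -- guarantees that index 0 is present.
  set t' : ℕ → Set ℤ := fun i => if i ∈ s then t i else Set.univ with ht'
  have hbox : Set.pi (s : Set ℕ) t = Set.pi (Finset.range (N + 1) : Set ℕ) t' := by
    ext ω
    simp only [Set.mem_pi, Finset.mem_coe, ht']
    constructor
    · intro h i _
      by_cases hi : i ∈ s <;> simp [hi, h]
    · intro h i hi
      have := h i (Finset.range_mono (Nat.le_succ N) (hN hi))
      simpa [hi] using this
  have hprod : ∏ i ∈ s, stepLaw p (t i) = ∏ i ∈ Finset.range (N + 1), stepLaw p (t' i) := by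
    rw [← Finset.prod_subset (hN.trans (Finset.range_mono (Nat.le_succ N)))]
    · exact Finset.prod_congr rfl fun i hi => by simp [ht', hi]
    · intro i _ hi
      simp [ht', hi]
  rw [hbox, hprod, Measure.map_apply measurable_consStep
    (MeasurableSet.pi (Finset.countable_toSet _) fun i _ => .of_discrete)]
  have hpre : (fun z : ℤ × (ℕ → ℤ) => consStep z.1 z.2) ⁻¹'
      Set.pi (Finset.range (N + 1) : Set ℕ) t' =
      t' 0 ×ˢ Set.pi (Finset.range N : Set ℕ) (fun i => t' (i + 1)) := by
    ext ⟨y, ω⟩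
    simp only [Set.mem_preimage, Set.mem_pi, Finset.mem_coe, Finset.mem_range, Set.mem_prod]
    constructor
    · intro h
      exact ⟨h 0 (Nat.succ_pos _), fun i hi => h (i + 1) (by omega)⟩
    · rintro ⟨h0, h⟩ i hi
      cases i with
      | zero => exact h0
      | succ i => exact h i (by omega)
  rw [hpre, Measure.prod_prod, stepsLaw, Measure.infinitePi_pi _ fun i _ => .of_discrete,
    Finset.prod_range_succ']
  exact mul_comm _ _

/-- The probability of the step `k - 3`. -/
noncomputable def stepProb (p : ℝ) (k : ℕ) : ℝ := Nat.choose 6 k * p ^ k * (1 - p) ^ (6 - k)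

lemma stepProb_nonneg (p : unitInterval) (k : ℕ) : 0 ≤ stepProb p k :=
  binomial_nonneg

/-- Conditioning on the first step. -/
lemma stepsLaw_real_eq_sum (p : unitInterval) {A : Set (ℕ → ℤ)} (hA : MeasurableSet A) :
    (stepsLaw p).real A = ∑ k ∈ Finset.range 7,
      stepProb p k * (stepsLaw p).real {ω | consStep ((k : ℤ) - 3) ω ∈ A} := by
  have h1 : stepsLaw p A = ∑ k ∈ Finset.range 7, ENNReal.ofReal (stepProb p k) *
      stepsLaw p {ω | consStep ((k : ℤ) - 3) ω ∈ A} := by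
    conv_lhs => rw [← map_consStep p]
    rw [Measure.map_apply measurable_consStep hA,
      Measure.prod_apply (measurable_consStep hA), stepLaw,
      lintegral_map (measurable_measure_prodMk_left (measurable_consStep hA)) .of_discrete,
      binomial_eq_sum_dirac, lintegral_finsetSum_measure]
    have : Finset.Iic 6 = Finset.range 7 := by ext; simp; omega
    rw [this]
    refine Finset.sum_congr rfl fun k _ => ?_
    rw [lintegral_smul_measure, lintegral_dirac]
    rfl
  rw [Measure.real, h1, ENNReal.toReal_sum fun k _ => ENNReal.mul_ne_top (by simp) (by simp)]
  refine Finset.sum_congr rfl fun k _ => ?_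
  rw [ENNReal.toReal_mul, ENNReal.toReal_ofReal (stepProb_nonneg p k), Measure.real]

/-! ### Last visits and the Green function. -/

/-- The displacement of the walk after `n` steps. -/
def partialSum (ω : ℕ → ℤ) (n : ℕ) : ℤ := ∑ i ∈ Finset.range n, ω i

lemma partialSum_zero (ω : ℕ → ℤ) : partialSum ω 0 = 0 := rfl

lemma partialSum_consStep (x : ℤ) (ω : ℕ → ℤ) (n : ℕ) :
    partialSum (consStep x ω) (n + 1) = x + partialSum ω n := by
  rw [partialSum, Finset.sum_range_succ', add_comm]
  rfl

@[fun_prop]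
lemma measurable_partialSum (n : ℕ) : Measurable (fun ω => partialSum ω n) := by
  unfold partialSum
  fun_prop

lemma measurableSet_partialSum_eq (n : ℕ) (j : ℤ) : MeasurableSet {ω | partialSum ω n = j} :=
  measurable_partialSum n (measurableSet_singleton j)

/-- The probability that the displacement after `n` steps is `j`. -/
noncomputable def stepsProb (p : unitInterval) (n : ℕ) (j : ℤ) : ℝ :=
  (stepsLaw p).real {ω | partialSum ω n = j}

lemma stepsProb_nonneg (p : unitInterval) (n : ℕ) (j : ℤ) : 0 ≤ stepsProb p n j :=
  measureReal_nonneg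

lemma stepsProb_zero (p : unitInterval) (j : ℤ) :
    stepsProb p 0 j = if j = 0 then 1 else 0 := by
  unfold stepsProb
  by_cases hj : j = 0
  · simp [hj, partialSum_zero]
  · simp [hj, partialSum_zero, Ne.symm hj]

lemma stepsProb_succ (p : unitInterval) (n : ℕ) (j : ℤ) :
    stepsProb p (n + 1) j
      = ∑ k ∈ Finset.range 7, stepProb p k * stepsProb p n (j - (k - 3)) := by
  rw [stepsProb, stepsLaw_real_eq_sum p (measurableSet_partialSum_eq _ _)]
  refine Finset.sum_congr rfl fun k _ => ?_
  congr 2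
  ext ω
  simp only [Set.mem_ofPred_eq, partialSum_consStep]
  omega

/-- The event that the displacement is `j` at time `n` and never again. -/
def lastVisit (n : ℕ) (j : ℤ) : Set (ℕ → ℤ) :=
  {ω | partialSum ω n = j ∧ ∀ m, n < m → partialSum ω m ≠ j}

lemma measurableSet_lastVisit (n : ℕ) (j : ℤ) : MeasurableSet (lastVisit n j) := by
  have : lastVisit n j = {ω | partialSum ω n = j} ∩
      ⋂ m, ⋂ (_ : n < m), {ω | partialSum ω m = j}ᶜ := by
    ext ω; simp [lastVisit]
  rw [this]
  exact (measurableSet_partialSum_eq _ _).inter <| .iInter fun m => .iInter fun _ =>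
    (measurableSet_partialSum_eq _ _).compl

lemma nu_eq (p : unitInterval) (j : ℤ) :
    nu p j = (stepsLaw p).real {ω | ∃ n, 1 ≤ n ∧ partialSum ω n = j} := by
  unfold nu position partialSum
  congr 1
  ext ω
  simp only [Set.mem_ofPred_eq]
  refine exists_congr fun n => and_congr_right fun _ => ?_
  constructor <;> intro h <;> linarith

lemma real_lastVisit_zero (p : unitInterval) :
    (stepsLaw p).real (lastVisit 0 0) = 1 - nu p 0 := by
  rw [nu_eq, ← probReal_compl_eq_one_sub]
  · congr 1
    ext ω
    simp only [lastVisit, partialSum_zero, Set.mem_ofPred_eq, true_and, Set.mem_compl_iff,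
      not_exists, not_and]
    rfl
  · have : {ω : ℕ → ℤ | ∃ n, 1 ≤ n ∧ partialSum ω n = 0} =
        ⋃ n, ⋃ (_ : 1 ≤ n), {ω | partialSum ω n = 0} := by ext ω; simp
    rw [this]
    exact .iUnion fun n => .iUnion fun _ => measurableSet_partialSum_eq _ _

/-- This is the Markov property at time n: after the visit the walk starts afresh and must never
return. Removing first steps by induction avoids conditioning on the past. -/
lemma real_lastVisit (p : unitInterval) (n : ℕ) (j : ℤ) :
    (stepsLaw p).real (lastVisit n j) = stepsProb p n j * (1 - nu p 0) := by
  induction n generalizing j with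
  | zero =>
    rw [stepsProb_zero]
    by_cases hj : j = 0
    · subst hj
      simp [real_lastVisit_zero]
    · have : lastVisit 0 j = ∅ := by
        ext ω
        simp [lastVisit, partialSum_zero, Ne.symm hj]
      simp [this, hj]
  | succ n ih =>
    rw [stepsLaw_real_eq_sum p (measurableSet_lastVisit _ _), stepsProb_succ, Finset.sum_mul]
    refine Finset.sum_congr rfl fun k _ => ?_
    rw [mul_assoc, ← ih]
    congr 2
    ext ω
    simp only [lastVisit, Set.mem_ofPred_eq, partialSum_consStep]
    refine and_congr (by omega) ⟨fun h m hm => ?_, fun h m hm => ?_⟩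
    · have := h (m + 1) (by omega)
      rw [partialSum_consStep] at this
      omega
    · obtain ⟨m, rfl⟩ : ∃ m', m = m' + 1 := ⟨m - 1, by omega⟩
      have := h m (by omega)
      rw [partialSum_consStep]
      omega

/-- Decomposition of the hitting event by the time of the last visit. -/
lemma hasSum_nu (p : unitInterval) (j : ℤ) (hs : Summable fun n => stepsProb p n j) :
    HasSum (fun n => stepsProb p (n + 1) j * (1 - nu p 0)) (nu p j) := by
  have hdisj : Pairwise (Function.onFun Disjoint fun n => lastVisit (n + 1) j) := by
    intro m n hmn
    rw [Function.onFun, Set.disjoint_left]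
    rintro ω ⟨h1, h2⟩ ⟨h3, h4⟩
    rcases lt_or_gt_of_ne hmn with h | h
    · exact h2 _ (by omega) h3
    · exact h4 _ (by omega) h1
  -- Borel–Cantelli: almost surely j is visited finitely often, so a last visit exists whenever
  -- there is a visit.
  have hfin : stepsLaw p (limsup (fun n => {ω | partialSum ω n = j}) atTop) = 0 := by
    refine measure_limsup_atTop_eq_zero ?_
    have : (fun n => stepsLaw p {ω | partialSum ω n = j})
        = fun n => ENNReal.ofReal (stepsProb p n j) := by
      ext n
      rw [stepsProb, ofReal_measureReal]
    rw [this, ← ENNReal.ofReal_tsum_of_nonneg (fun n => stepsProb_nonneg p n j) hs]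
    exact ENNReal.ofReal_ne_top
  have hae : {ω | ∃ n, 1 ≤ n ∧ partialSum ω n = j} =ᵐ[stepsLaw p] ⋃ n, lastVisit (n + 1) j := by
    have hio : ∀ᵐ ω ∂stepsLaw p, ω ∉ limsup (fun n => {ω | partialSum ω n = j}) atTop :=
      measure_eq_zero_iff_ae_notMem.1 hfin
    filter_upwards [hio] with ω hω
    refine propext ⟨?_, ?_⟩
    · rintro ⟨n, hn, hnj⟩
      rw [mem_limsup_iff_frequently_mem, not_frequently, eventually_atTop] at hω
      obtain ⟨N, hN⟩ := hω
      have hex : ∃ M, ∀ m, M < m → partialSum ω m ≠ j := ⟨N, fun m hm => hN m hm.le⟩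
      classical
      -- The least time after which j is avoided is itself a visit, since otherwise its predecessor
      -- would do. It is at least n ≥ 1, which justifies the index M − 1.
      have hspec := Nat.find_spec hex
      have hmin := @Nat.find_min _ _ hex
      set M := Nat.find hex
      have hnM : n ≤ M := by
        by_contra h
        exact hspec n (by omega) hnj
      have hM : partialSum ω M = j := by
        by_contra h
        refine hmin (m := M - 1) (by omega) fun m hm => ?_
        rcases (show M ≤ m by omega).eq_or_lt with h' | h'
        · rwa [← h']
        · exact hspec m h'
      refine Set.mem_iUnion.2 ⟨M - 1, ?_⟩
      rw [Nat.sub_add_cancel (hn.trans hnM)]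
      exact ⟨hM, hspec⟩
    · intro h
      obtain ⟨n, hn⟩ := Set.mem_iUnion.1 h
      exact ⟨n + 1, by omega, hn.1⟩
  have h1 : stepsLaw p (⋃ n, lastVisit (n + 1) j) ≠ ⊤ := measure_ne_top _ _
  have h2 := measure_iUnion (μ := stepsLaw p) hdisj fun n => measurableSet_lastVisit (n + 1) j
  rw [h2] at h1
  have h3 := (ENNReal.summable_toReal h1).hasSum
  rw [← ENNReal.tsum_toReal_eq fun n => measure_ne_top _ _, ← h2] at h3
  rw [nu_eq p j, measureReal_congr hae]
  simp only [← real_lastVisit]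
  exact h3

/-- The hitting probabilities in terms of the Green function. -/
lemma nu_of_green (p : unitInterval) {G : ℤ → ℝ}
    (hG : ∀ j, HasSum (fun n => stepsProb p n j) (G j)) :
    1 - nu p 0 = 1 / G 0 ∧ ∀ j ≠ 0, nu p j = G j / G 0 := by
  have key : ∀ j, nu p j = (G j - if j = 0 then 1 else 0) * (1 - nu p 0) := by
    intro j
    have h1 := (hasSum_nat_add_iff' 1).2 (hG j)
    simp only [Finset.sum_range_one, stepsProb_zero] at h1
    exact (hasSum_nu p j (hG j).summable).unique (h1.mul_right _)
  have h0 := key 0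
  simp only [if_true] at h0
  -- The case j = 0 yields both the value of 1 − ν_0 and the nonvanishing of G 0.
  have h1 : G 0 * (1 - nu p 0) = 1 := by linear_combination -h0
  have hne : G 0 ≠ 0 := left_ne_zero_of_mul_eq_one h1
  refine ⟨by field_simp; linear_combination h1, fun j hj => ?_⟩
  rw [key j, if_neg hj]
  field_simp
  linear_combination G j * h1

/-! ### Inverting 1 − T³ through the cube roots of unity. -/

/-- Convolution on `ℤ` with the weights `x, 2x, x`. -/
def conv (x : ℂ) : (ℤ → ℂ) →ₗ[ℂ] (ℤ → ℂ) where
  toFun f j := x * (f (j - 1) + 2 * f j + f (j + 1))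
  map_add' f g := by ext j; simp only [Pi.add_apply]; ring
  map_smul' c f := by ext j; simp only [Pi.smul_apply, smul_eq_mul, RingHom.id_apply]; ring

lemma conv_apply (x : ℂ) (f : ℤ → ℂ) (j : ℤ) :
    conv x f j = x * (f (j - 1) + 2 * f j + f (j + 1)) := rfl

lemma norm_conv_pow_le (x : ℂ) {f : ℤ → ℂ} {C : ℝ} (hf : ∀ j, ‖f j‖ ≤ C) (n : ℕ) (j : ℤ) :
    ‖(conv x ^ n) f j‖ ≤ (4 * ‖x‖) ^ n * C := by
  induction n generalizing j with
  | zero => simpa using hf j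
  | succ n ih =>
    rw [pow_succ', Module.End.mul_apply, conv_apply, norm_mul]
    have h : ‖(conv x ^ n) f (j - 1) + 2 * (conv x ^ n) f j + (conv x ^ n) f (j + 1)‖
        ≤ 4 * ((4 * ‖x‖) ^ n * C) := by
      refine (norm_add₃_le).trans ?_
      rw [norm_mul, Complex.norm_ofNat]
      linarith [ih (j - 1), ih j, ih (j + 1)]
    calc _ ≤ ‖x‖ * (4 * ((4 * ‖x‖) ^ n * C)) := by gcongr
      _ = _ := by ring

/-- The unit mass at `0`. -/
def unitMass (j : ℤ) : ℂ := if j = 0 then 1 else 0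

/-- The kernel `ρ ^ |j| / s` with `ρ = (1 - s) / (1 + s)`. -/
noncomputable def kernel (s : ℂ) (j : ℤ) : ℂ := ((1 - s) / (1 + s)) ^ j.natAbs / s

/-- The ratio ρ satisfies ρ = y(1 + ρ)², so ρ^|j| solves the homogeneous equation away from 0; the
factor 1/s produces the unit mass at 0. -/
lemma kernel_eq {s y x w : ℂ} (hs : s ≠ 0) (hs1 : 1 + s ≠ 0) (hy : w * x = y)
    (hsy : s ^ 2 = 1 - 4 * y) :
    kernel s = unitMass + w • conv x (kernel s) := by
  ext j
  obtain rfl : y = (1 - s ^ 2) / 4 := by linear_combination hsy / 4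
  simp only [Pi.add_apply, Pi.smul_apply, smul_eq_mul, conv_apply, ← mul_assoc, hy]
  have hr : (1 - s) / (1 + s) = (1 - s ^ 2) / 4 * (1 + (1 - s) / (1 + s)) ^ 2 := by
    field_simp; ring
  obtain ⟨n, rfl | rfl⟩ := j.eq_nat_or_neg
  · cases n with
    | zero => simp [kernel, unitMass]; field_simp; ring
    | succ n =>
      have e1 : ((n + 1 : ℕ) - 1 : ℤ).natAbs = n := by omega
      have e2 : ((n + 1 : ℕ) + 1 : ℤ).natAbs = n + 2 := by omega
      have e3 : ((n + 1 : ℕ) : ℤ) ≠ 0 := by omega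
      simp only [kernel, unitMass, e1, e2, e3, if_false, Int.natAbs_natCast]
      linear_combination ((1 - s) / (1 + s)) ^ n / s * hr
  · cases n with
    | zero => simp [kernel, unitMass]; field_simp; ring
    | succ n =>
      have e1 : (-(n + 1 : ℕ) - 1 : ℤ).natAbs = n + 2 := by omega
      have e2 : (-(n + 1 : ℕ) + 1 : ℤ).natAbs = n := by omega
      have e3 : (-(n + 1 : ℕ) : ℤ) ≠ 0 := by omega
      simp only [kernel, unitMass, e1, e2, e3, if_false, Int.natAbs_neg, Int.natAbs_natCast]
      linear_combination ((1 - s) / (1 + s)) ^ n / s * hr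

/-- In the right half plane |1 − s| ≤ |1 + s|, hence |ρ| ≤ 1. -/
lemma norm_kernel_le {s : ℂ} (hs : 0 ≤ s.re) (j : ℤ) : ‖kernel s j‖ ≤ 1 / ‖s‖ := by
  rw [kernel, norm_div, norm_pow, norm_div]
  gcongr
  refine pow_le_one₀ (by positivity) (div_le_one_of_le₀ ?_ (norm_nonneg _))
  rw [Complex.norm_def, Complex.norm_def]
  refine Real.sqrt_le_sqrt ?_
  simp only [Complex.normSq_apply, Complex.sub_re, Complex.add_re, Complex.sub_im,
    Complex.add_im, Complex.one_re, Complex.one_im]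
  nlinarith

/-- Averaging the kernels over the three cube roots of unity inverts `1 - conv x ^ 3`. -/
lemma average_eq {x : ℂ} {w : ℂ} (hw : 1 + w + w ^ 2 = 0) {g g₁ g₂ : ℤ → ℂ}
    (hg : g = unitMass + (1 : ℂ) • conv x g) (hg₁ : g₁ = unitMass + w • conv x g₁)
    (hg₂ : g₂ = unitMass + w ^ 2 • conv x g₂) :
    (1 / 3 : ℂ) • (g + g₁ + g₂) = unitMass + (conv x ^ 3) ((1 / 3 : ℂ) • (g + g₁ + g₂)) := by
  have hw3 : w ^ 3 = 1 := by linear_combination (w - 1) * hw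
  -- Substituting the equation into itself twice produces v³ = 1 in front of the cubed operator. The
  -- terms in v and v² cancel in the average over 1, w, w².
  have key : ∀ (v : ℂ) (k : ℤ → ℂ), v ^ 3 = 1 → k = unitMass + v • conv x k →
      k = unitMass + v • conv x unitMass + v ^ 2 • conv x (conv x unitMass)
        + (conv x ^ 3) k := by
    intro v k hv hk
    have e1 : v • conv x k = v • conv x unitMass + v ^ 2 • conv x (conv x k) := by
      conv_lhs => rw [hk]
      rw [map_add, map_smul, smul_add, smul_smul, sq]
    have e2 : v ^ 2 • conv x (conv x k) = v ^ 2 • conv x (conv x unitMass) + (conv x ^ 3) k := by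
      conv_lhs => rw [hk]
      rw [map_add, map_add, map_smul, map_smul, smul_add, smul_smul, ← pow_succ, hv, one_smul]
      rfl
    conv_lhs => rw [hk, e1, e2]
    abel
  have k1 := key 1 g (by norm_num) hg
  have k2 := key w g₁ hw3 hg₁
  have k3 := key (w ^ 2) g₂ (by rw [← pow_mul, mul_comm, pow_mul, hw3, one_pow]) hg₂
  ext j
  have k1 := congrFun k1 j
  have k2 := congrFun k2 j
  have k3 := congrFun k3 j
  simp only [map_smul, map_add, Pi.add_apply, Pi.smul_apply, smul_eq_mul] at *
  linear_combination (1 / 3) * (k1 + k2 + k3) + (1 / 3) * conv x unitMass j * hw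
    + (1 / 3) * conv x (conv x unitMass) j * (hw + w * (hw3))

/-- A bounded solution of `f = unitMass + conv x ^ 3 f` is the sum of the iterates. -/
lemma tendsto_sum_conv {x : ℂ} (hx : 4 * ‖x‖ < 1) {f : ℤ → ℂ} {C : ℝ} (hC : ∀ j, ‖f j‖ ≤ C)
    (hf : f = unitMass + (conv x ^ 3) f) (j : ℤ) :
    Tendsto (fun N => ∑ n ∈ Finset.range N, (conv x ^ (3 * n)) unitMass j) atTop (𝓝 (f j)) := by
  -- Telescoping: the error after N terms is T^(3N) f, which decays geometrically because f is
  -- bounded and T has norm at most 4‖x‖ < 1.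
  have h : ∀ N, f - ∑ n ∈ Finset.range N, (conv x ^ (3 * n)) unitMass
      = (conv x ^ (3 * N)) f := by
    intro N
    induction N with
    | zero => simp
    | succ N ih =>
      rw [Finset.sum_range_succ, ← sub_sub, ih, ← map_sub, Nat.mul_succ, pow_add,
        Module.End.mul_apply]
      congr 1
      conv_lhs => rw [hf]
      simp
  have h2 : Tendsto (fun N => (conv x ^ (3 * N)) f j) atTop (𝓝 0) := by
    refine squeeze_zero_norm (fun N => norm_conv_pow_le x hC (3 * N) j) ?_
    have h4 : Tendsto (fun n : ℕ => (4 * ‖x‖) ^ n) atTop (𝓝 0) :=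
      tendsto_pow_atTop_nhds_zero_of_lt_one (by positivity) hx
    have h3 : Tendsto (fun N : ℕ => 3 * N) atTop atTop :=
      tendsto_atTop_mono (fun N => by simp only [id]; omega) tendsto_id
    simpa using (h4.comp h3).mul_const C
  have h3 := (tendsto_const_nhds (x := f j)).sub h2
  rw [sub_zero] at h3
  refine h3.congr fun N => ?_
  rw [← h N]
  simp

/-- The displacement probabilities are tilted convolution powers. -/
lemma stepsProb_eq (p : unitInterval) (hp : 0 < (p : ℝ)) (hp1 : (p : ℝ) < 1) (n : ℕ) (j : ℤ) :
    (stepsProb p n j : ℂ) = ((p : ℝ) / (1 - p) : ℂ) ^ j *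
      (conv ((p : ℝ) * (1 - p) : ℂ) ^ (3 * n)) unitMass j := by
  set P : ℂ := ((p : ℝ) : ℂ)
  have hP : P ≠ 0 := Complex.ofReal_ne_zero.2 hp.ne'
  have hP1 : 1 - P ≠ 0 := by
    rw [← Complex.ofReal_one, ← Complex.ofReal_sub]
    exact Complex.ofReal_ne_zero.2 (by linarith)
  induction n generalizing j with
  | zero =>
    rw [stepsProb_zero]
    by_cases hj : j = 0 <;> simp [hj, unitMass]
  | succ n ih =>
    rw [stepsProb_succ, Nat.mul_succ, add_comm, pow_add, Module.End.mul_apply]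
    set g := (conv (P * (1 - P)) ^ (3 * n)) unitMass
    have hr : P / (1 - P) ≠ 0 := div_ne_zero hP hP1
    have ih' : ∀ k : ℕ, (stepsProb p n (j - (k - 3)) : ℂ)
        = (P / (1 - P)) ^ j * ((1 - P) / P) ^ k * (P / (1 - P)) ^ 3 * g (j - (k - 3)) := fun k => by
      rw [ih, show j - ((k : ℤ) - 3) = j - k + (3 : ℕ) by push_cast; ring, zpow_add₀ hr,
        zpow_sub₀ hr, zpow_natCast, zpow_natCast, ← inv_div P, inv_pow]
      field_simp
    -- The weights 1, 2, 1 are those of (1 + E)²/E, so the cube has the weights C(6, k) of the step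
    -- law; the tilt turns each p^k q^(6−k) into (pq)³.
    have e : (conv (P * (1 - P)) ^ 3) g j = (P * (1 - P)) ^ 3 * (g (j - ((0 : ℕ) - 3))
        + 6 * g (j - ((1 : ℕ) - 3)) + 15 * g (j - ((2 : ℕ) - 3)) + 20 * g (j - ((3 : ℕ) - 3))
        + 15 * g (j - ((4 : ℕ) - 3)) + 6 * g (j - ((5 : ℕ) - 3)) + g (j - ((6 : ℕ) - 3))) := by
      simp only [pow_succ, pow_zero, one_mul, Module.End.mul_apply, conv_apply]
      push_cast
      ring_nf
    rw [Complex.ofReal_sum]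
    simp only [Complex.ofReal_mul, ih']
    simp only [Finset.sum_range_succ, Finset.sum_range_zero, stepProb, e]
    have hc : Nat.choose 6 0 = 1 ∧ Nat.choose 6 1 = 6 ∧ Nat.choose 6 2 = 15 ∧
      Nat.choose 6 3 = 20 ∧ Nat.choose 6 4 = 15 ∧ Nat.choose 6 5 = 6 ∧ Nat.choose 6 6 = 1 := by
      decide
    obtain ⟨h0, h1, h2, h3, h4, h5, h6⟩ := hc
    simp only [h0, h1, h2, h3, h4, h5, h6, Complex.ofReal_mul, Complex.ofReal_pow,
      Complex.ofReal_sub, Complex.ofReal_one, Complex.ofReal_natCast]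
    generalize g (j - ((0 : ℕ) - 3)) = g0
    generalize g (j - ((1 : ℕ) - 3)) = g1
    generalize g (j - ((2 : ℕ) - 3)) = g2
    generalize g (j - ((3 : ℕ) - 3)) = g3
    generalize g (j - ((4 : ℕ) - 3)) = g4
    generalize g (j - ((5 : ℕ) - 3)) = g5
    generalize g (j - ((6 : ℕ) - 3)) = g6
    generalize (P / (1 - P)) ^ j = R
    change 0 + _ * P ^ 0 * (1 - P) ^ (6 - 0) * _ + _ * P ^ 1 * (1 - P) ^ (6 - 1) * _
      + _ * P ^ 2 * (1 - P) ^ (6 - 2) * _ + _ * P ^ 3 * (1 - P) ^ (6 - 3) * _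
      + _ * P ^ 4 * (1 - P) ^ (6 - 4) * _ + _ * P ^ 5 * (1 - P) ^ (6 - 5) * _
      + _ * P ^ 6 * (1 - P) ^ (6 - 6) * _ = _
    norm_num
    field_simp

/-! ### Square roots of 1 − 4pqω. -/

/-- The real part of the square roots of `1 - 4 p q ω` for the primitive cube roots of unity
`ω`. -/
noncomputable def rootRe (p : ℝ) : ℝ := √((theta p + 1 + 2 * (p * (1 - p))) / 2)

/-- `√3` times the imaginary part of the square root of `1 - 4 p q ω`. -/
noncomputable def rootIm (p : ℝ) : ℝ := 3 * (p * (1 - p)) / rootRe p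

section Roots
variable {p : ℝ}

lemma theta_sq (hp : 0 < p) (hp1 : p < 1) :
    theta p ^ 2 = 1 + 4 * (p * (1 - p)) + 16 * (p * (1 - p)) ^ 2 := by
  have : 0 < p * (1 - p) := mul_pos hp (by linarith)
  rw [theta, Real.sq_sqrt (by nlinarith [sq_nonneg (p * (1 - p))])]
  ring

lemma prod_lt_quarter (hp1 : p < 1 / 2) : p * (1 - p) < 1 / 4 := by
  nlinarith [mul_pos (sub_pos.2 hp1) (sub_pos.2 hp1)]

lemma theta_bounds (hp : 0 < p) (hp1 : p < 1 / 2) :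
    1 + 2 * (p * (1 - p)) ≤ theta p ∧ theta p ≤ 1 + 3 * (p * (1 - p)) := by
  have h := theta_sq hp (by linarith)
  have h0 : 0 ≤ theta p := Real.sqrt_nonneg _
  have hx : 0 < p * (1 - p) := mul_pos hp (by linarith)
  have hx1 := prod_lt_quarter hp1
  constructor
  · refine le_of_sq_le_sq ?_ h0
    nlinarith
  · refine le_of_sq_le_sq ?_ (by positivity)
    nlinarith

lemma rootRe_sq (hp : 0 < p) (hp1 : p < 1 / 2) :
    2 * rootRe p ^ 2 = theta p + 1 + 2 * (p * (1 - p)) := by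
  have := (theta_bounds hp hp1).1
  have hx : 0 < p * (1 - p) := mul_pos hp (by linarith)
  rw [rootRe, Real.sq_sqrt (by linarith)]
  ring

lemma one_lt_rootRe (hp : 0 < p) (hp1 : p < 1 / 2) : 1 < rootRe p := by
  have := (theta_bounds hp hp1).1
  have hx : 0 < p * (1 - p) := mul_pos hp (by linarith)
  rw [rootRe, Real.lt_sqrt (by norm_num)]
  linarith

lemma rootRe_mul_rootIm (hp : 0 < p) (hp1 : p < 1 / 2) :
    rootRe p * rootIm p = 3 * (p * (1 - p)) := by
  have := one_lt_rootRe hp hp1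
  rw [rootIm]
  field_simp

lemma rootIm_eq (hp : 0 < p) (hp1 : p < 1 / 2) :
    2 * (p * (1 - p)) * rootIm p = rootRe p * (theta p - 1 - 2 * (p * (1 - p))) := by
  have h1 := one_lt_rootRe hp hp1
  have h2 := rootRe_sq hp hp1
  have h3 := rootRe_mul_rootIm hp hp1
  have h4 := theta_sq hp (by linarith)
  have ha : rootRe p ≠ 0 := by linarith
  refine mul_left_cancel₀ ha ?_
  linear_combination 2 * (p * (1 - p)) * h3 - (theta p - 1 - 2 * (p * (1 - p))) / 2 * h2 - h4 / 2

lemma rootIm_sq (hp : 0 < p) (hp1 : p < 1 / 2) :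
    2 * rootIm p ^ 2 = 3 * (theta p - 1 - 2 * (p * (1 - p))) := by
  have h1 := one_lt_rootRe hp hp1
  have h3 := rootRe_mul_rootIm hp hp1
  have h5 := rootIm_eq hp hp1
  have ha : rootRe p ≠ 0 := by linarith
  refine mul_left_cancel₀ ha ?_
  linear_combination 2 * rootIm p * h3 + 3 * h5

end Roots

/-- A complex square root of `-3`. -/
noncomputable def sqrtNegThree : ℂ := (√3 : ℝ) * Complex.I

lemma sqrtNegThree_sq : sqrtNegThree ^ 2 = -3 := by
  rw [sqrtNegThree, mul_pow, Complex.I_sq, ← Complex.ofReal_pow, Real.sq_sqrt (by norm_num)]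
  norm_num

/-- A square root of `1 - 4 p q ω`. -/
noncomputable def root (p : ℝ) : ℂ := rootRe p - sqrtNegThree * rootIm p / 3

/-- A square root of `1 - 4 p q ω²`. -/
noncomputable def rootConj (p : ℝ) : ℂ := rootRe p + sqrtNegThree * rootIm p / 3

/-- A primitive cube root of unity. -/
noncomputable def cubeRoot : ℂ := (-1 + sqrtNegThree) / 2

lemma cubeRoot_eq : 1 + cubeRoot + cubeRoot ^ 2 = 0 := by
  rw [cubeRoot]
  linear_combination sqrtNegThree_sq / 4

lemma root_re (p : ℝ) : (root p).re = rootRe p := by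
  simp [root, sqrtNegThree]

lemma rootConj_re (p : ℝ) : (rootConj p).re = rootRe p := by
  simp [rootConj, sqrtNegThree]

section RootsComplex
variable {p : ℝ}

lemma root_mul_rootConj (hp : 0 < p) (hp1 : p < 1 / 2) : root p * rootConj p = theta p := by
  have h1 := rootRe_sq hp hp1
  have h2 := rootIm_sq hp hp1
  rw [root, rootConj]
  have h : (rootRe p : ℂ) ^ 2 + rootIm p ^ 2 / 3 = theta p := by
    exact_mod_cast (by linear_combination h1 / 2 + h2 / 6 :
      rootRe p ^ 2 + rootIm p ^ 2 / 3 = theta p)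
  linear_combination h - rootIm p ^ 2 / 9 * sqrtNegThree_sq

lemma root_sq (hp : 0 < p) (hp1 : p < 1 / 2) :
    root p ^ 2 = 1 - 4 * (cubeRoot * (p * (1 - p))) ∧
    rootConj p ^ 2 = 1 - 4 * (cubeRoot ^ 2 * (p * (1 - p))) := by
  have h1 := rootRe_sq hp hp1
  have h2 := rootIm_sq hp hp1
  have h : (rootRe p : ℂ) ^ 2 - rootIm p ^ 2 / 3 = 1 + 2 * (p * (1 - p)) := by
    exact_mod_cast (by linear_combination h1 / 2 - h2 / 6 :
      rootRe p ^ 2 - rootIm p ^ 2 / 3 = 1 + 2 * (p * (1 - p)))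
  have h3 : (rootRe p : ℂ) * rootIm p = 3 * (p * (1 - p)) := by
    exact_mod_cast rootRe_mul_rootIm hp hp1
  have hz := sqrtNegThree_sq
  rw [root, rootConj, cubeRoot]
  constructor
  · linear_combination h - 2 / 3 * sqrtNegThree * h3 + rootIm p ^ 2 / 9 * hz
  · linear_combination h + 2 / 3 * sqrtNegThree * h3 + (rootIm p ^ 2 / 9 + p * (1 - p)) * hz

end RootsComplex

/-! ### The Green function and its values at 0, 1, 2, 3. -/

/-- The tilted Green function. -/
noncomputable def greenTilt (p : ℝ) : ℤ → ℂ :=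
  (1 / 3 : ℂ) • (kernel ((1 - 2 * p : ℝ) : ℂ) + kernel (root p) + kernel (rootConj p))

lemma ne_zero_of_re_pos {s : ℂ} (hs : 0 < s.re) : s ≠ 0 ∧ 1 + s ≠ 0 := by
  constructor <;> intro h
  · simp [h] at hs
  · have : (1 + s).re = 0 := by rw [h]; simp
    rw [Complex.add_re, Complex.one_re] at this
    linarith

lemma greenTilt_eq {p : ℝ} (hp : 0 < p) (hp1 : p < 1 / 2) :
    greenTilt p = unitMass + (conv (p * (1 - p)) ^ 3) (greenTilt p) := by
  have ha := one_lt_rootRe hp hp1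
  have h1 := ne_zero_of_re_pos (s := ((1 - 2 * p : ℝ) : ℂ)) (by simp; linarith)
  have h2 := ne_zero_of_re_pos (s := root p) (by rw [root_re]; linarith)
  have h3 := ne_zero_of_re_pos (s := rootConj p) (by rw [rootConj_re]; linarith)
  exact average_eq cubeRoot_eq
    (kernel_eq h1.1 h1.2 rfl (by push_cast; ring))
    (kernel_eq h2.1 h2.2 rfl (root_sq hp hp1).1) (kernel_eq h3.1 h3.2 rfl (root_sq hp hp1).2)

lemma exists_norm_greenTilt_le {p : ℝ} (hp : 0 < p) (hp1 : p < 1 / 2) :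
    ∃ C, ∀ j, ‖greenTilt p j‖ ≤ C := by
  have ha := one_lt_rootRe hp hp1
  refine ⟨‖(1 / 3 : ℂ)‖ * (1 / ‖((1 - 2 * p : ℝ) : ℂ)‖ + 1 / ‖root p‖ + 1 / ‖rootConj p‖),
    fun j => ?_⟩
  rw [greenTilt, Pi.smul_apply, norm_smul]
  gcongr
  refine norm_add₃_le.trans (add_le_add_three (norm_kernel_le ?_ j) (norm_kernel_le ?_ j)
    (norm_kernel_le ?_ j))
  · simp; linarith
  · rw [root_re]; linarith
  · rw [rootConj_re]; linarith

/-- The Green function of the walk. -/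
lemma hasSum_stepsProb (p : unitInterval) (hp : 0 < (p : ℝ)) (hp1 : (p : ℝ) < 1 / 2) (j : ℤ) :
    HasSum (fun n => stepsProb p n j) (((p : ℝ) / (1 - p)) ^ j * (greenTilt p j).re) := by
  -- Nonnegativity upgrades convergence of the partial sums to unconditional summability.
  rw [hasSum_iff_tendsto_nat_of_nonneg fun n => stepsProb_nonneg p n j]
  obtain ⟨C, hC⟩ := exists_norm_greenTilt_le hp hp1
  have hx : 4 * ‖((p : ℝ) * (1 - (p : ℝ)) : ℂ)‖ < 1 := by
    have h0 : 0 < (p : ℝ) * (1 - p) := mul_pos hp (by linarith)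
    have h1 := prod_lt_quarter hp1
    have : ((p : ℝ) * (1 - (p : ℝ)) : ℂ) = (((p : ℝ) * (1 - p) : ℝ) : ℂ) := by push_cast; ring
    rw [this, Complex.norm_real, Real.norm_of_nonneg h0.le]
    linarith
  have h := (tendsto_sum_conv hx hC (greenTilt_eq hp hp1) j).const_mul
    (((p : ℝ) / (1 - (p : ℝ)) : ℂ) ^ j)
  have h2 := (Complex.continuous_re.tendsto _).comp h
  have e : ((p : ℝ) / (1 - (p : ℝ)) : ℂ) ^ j = (((p : ℝ) / (1 - p)) ^ j : ℝ) := by push_cast; ring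
  have h3 : ((((p : ℝ) / (1 - (p : ℝ)) : ℂ) ^ j) * greenTilt p j).re
      = ((p : ℝ) / (1 - p)) ^ j * (greenTilt p j).re := by
    rw [e, Complex.re_ofReal_mul]
  rw [← h3]
  refine h2.congr fun N => ?_
  rw [Function.comp_apply, Finset.mul_sum,
    Finset.sum_congr rfl fun n _ => (stepsProb_eq p hp (by linarith) n j).symm,
    ← Complex.ofReal_sum, Complex.ofReal_re]

section Values
variable {p : ℝ}

lemma kernel_neg (s : ℂ) (j : ℤ) : kernel s (-j) = kernel s j := by simp [kernel]

lemma greenTilt_neg (p : ℝ) (j : ℤ) : greenTilt p (-j) = greenTilt p j := by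
  simp [greenTilt, kernel_neg]

/-- Rationalising gives ρ = (1 − s)²/(4y), and even powers of s are polynomials in y. Hence ρ^n / s
is affine in h = 1/s with coefficients in 1/y = v/x. -/
lemma kernel_values {s y v x h : ℂ} (hs : s ≠ 0) (hs1 : 1 + s ≠ 0) (hx : x ≠ 0)
    (hy : s ^ 2 = 1 - 4 * y) (hv : v * y = x) (hh : h * s = 1) :
    kernel s 0 = h ∧ kernel s 1 = (h - 1) * v / (2 * x) - h ∧
    kernel s 2 = (h - 1) * v ^ 2 / (2 * x ^ 2) - 2 * h * v / x + v / x + h ∧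
    kernel s 3 = (h - 1) * v ^ 3 / (2 * x ^ 3) - 3 * h * v ^ 2 / x ^ 2 + 2 * v ^ 2 / x ^ 2
      + 9 / 2 * h * v / x - 3 / 2 * v / x - h := by
  obtain rfl : h = 1 / s := by field_simp; exact hh
  obtain rfl : y = (1 - s ^ 2) / 4 := by linear_combination hy / 4
  subst hv
  have hv0 : v ≠ 0 := left_ne_zero_of_mul hx
  have hy0 : 1 - s ^ 2 ≠ 0 := by
    have := right_ne_zero_of_mul hx
    contrapose! this
    rw [this]; simp
  simp only [kernel]
  refine ⟨by simp, ?_, ?_, ?_⟩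
  · simp only [Int.natAbs_one]
    field_simp
    ring
  · rw [show (2 : ℤ).natAbs = 2 from rfl]
    field_simp
    ring
  · rw [show (3 : ℤ).natAbs = 3 from rfl]
    field_simp
    ring

lemma greenTilt_values (hp : 0 < p) (hp1 : p < 1 / 2) {x t a c θ : ℝ} (hx : x = p * (1 - p))
    (ht : t = 1 - 2 * p) (ha : a = rootRe p) (hc : c = rootIm p) (hθ : θ = theta p) :
    (greenTilt p 0).re = (1 / t + 2 * a / θ) / 3 ∧
    (greenTilt p 1).re = ((1 / t + (c - a) / θ) / (2 * x) - (1 / t + 2 * a / θ)) / 3 ∧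
    (greenTilt p 2).re = ((1 / t - (a + c) / θ) / (2 * x ^ 2) - 2 * (1 / t + (c - a) / θ) / x
      + (1 / t + 2 * a / θ)) / 3 ∧
    (greenTilt p 3).re = ((1 / t + 2 * a / θ - 3) / (2 * x ^ 3) - 3 * (1 / t - (a + c) / θ) / x ^ 2
      + 9 / 2 * (1 / t + (c - a) / θ) / x - (1 / t + 2 * a / θ)) / 3 := by
  have ha1 := one_lt_rootRe hp hp1
  have hx0 : 0 < x := hx ▸ mul_pos hp (by linarith)
  have ht0 : 0 < t := by linarith
  have hθ0 : 0 < θ := by have := (theta_bounds hp hp1).1; rw [← hx, ← hθ] at this; linarith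
  have hxc : (x : ℂ) ≠ 0 := Complex.ofReal_ne_zero.2 hx0.ne'
  have htc : (t : ℂ) ≠ 0 := Complex.ofReal_ne_zero.2 ht0.ne'
  have hθc : (θ : ℂ) ≠ 0 := Complex.ofReal_ne_zero.2 hθ0.ne'
  have hxp : (x : ℂ) = p * (1 - p) := by rw [hx]; push_cast; ring
  have h1 := ne_zero_of_re_pos (s := (t : ℂ)) (by simpa using ht0)
  have h2 := ne_zero_of_re_pos (s := root p) (by rw [root_re]; linarith)
  have h3 := ne_zero_of_re_pos (s := rootConj p) (by rw [rootConj_re]; linarith)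
  have hm := root_mul_rootConj hp hp1
  obtain ⟨hq1, hq2⟩ := root_sq hp hp1
  rw [← hθ] at hm
  rw [← hxp] at hq1 hq2
  have hw := cubeRoot_eq
  have hw3 : cubeRoot ^ 3 = 1 := by linear_combination (cubeRoot - 1) * hw
  obtain ⟨k10, k11, k12, k13⟩ := kernel_values h1.1 h1.2 hxc (y := x) (v := 1) (h := 1 / t)
    (by rw [hxp, ht]; push_cast; ring) (by ring) (by field_simp)
  -- The two nonreal roots have product θ, so each is inverted by its conjugate divided by θ; v is
  -- the inverse of the cube root of unity attached to s.
  obtain ⟨k20, k21, k22, k23⟩ := kernel_values h2.1 h2.2 hxc (v := cubeRoot ^ 2)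
    (h := rootConj p / θ) hq1 (by linear_combination (x : ℂ) * hw3)
    (by field_simp; linear_combination hm)
  obtain ⟨k30, k31, k32, k33⟩ := kernel_values h3.1 h3.2 hxc (v := cubeRoot)
    (h := root p / θ) hq2 (by linear_combination (x : ℂ) * hw3)
    (by field_simp; linear_combination hm)
  have hz := sqrtNegThree_sq
  set z := sqrtNegThree
  have hv2 : cubeRoot ^ 2 = (-1 - z) / 2 := by rw [cubeRoot]; linear_combination hz / 4
  have hv4 : (cubeRoot ^ 2) ^ 2 = cubeRoot := by linear_combination cubeRoot * hw3
  have hv6 : (cubeRoot ^ 2) ^ 3 = 1 := by linear_combination (cubeRoot ^ 3 + 1) * hw3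
  rw [hv4] at k22 k23
  rw [hv6] at k23
  rw [hw3] at k33
  rw [hv2] at k21 k22 k23 k32 k33
  have hcr : cubeRoot = (-1 + z) / 2 := rfl
  have hr1 : root p = a - z * c / 3 := by rw [ha, hc]; rfl
  have hr2 : rootConj p = a + z * c / 3 := by rw [ha, hc]; rfl
  have hG : ∀ j, greenTilt p j = 1 / 3 * (kernel t j + kernel (root p) j + kernel (rootConj p) j) := by
    intro j; rw [ht]; rfl
  have fin : ∀ j (y : ℝ), greenTilt p j = y → (greenTilt p j).re = y := by
    intro j y h; rw [h, Complex.ofReal_re]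
  refine ⟨fin _ _ ?_, fin _ _ ?_, fin _ _ ?_, fin _ _ ?_⟩
  · rw [hG, k10, k20, k30, hr1, hr2]
    push_cast
    ring
  · rw [hG, k11, k21, k31, hr1, hr2, hcr]
    push_cast
    field_simp
    ring_nf
    rw [hz]; ring
  · rw [hG, k12, k22, k32, hr1, hr2, hcr]
    push_cast
    field_simp
    ring_nf
    rw [hz]; ring
  · rw [hG, k13, k23, k33, hr1, hr2, hcr]
    push_cast
    field_simp
    ring_nf
    rw [hz]; ring

end Values

/-! ### Entries of the cycle matrix. -/

section Matrices
variable {p : ℝ}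

lemma hasSum_redMatrix (p : ℝ) (f : ℕ → ℝ) (i : ℕ) :
    HasSum (fun j => redMatrix p i j * f j) (p * f (i + 1) + (1 - p) * f i) := by
  have h : HasSum (fun j => redMatrix p i j * f j)
      (∑ j ∈ {i + 1, i}, redMatrix p i j * f j) := hasSum_sum_of_ne_finset_zero (by
      intro b hb
      simp only [Finset.mem_insert, Finset.mem_singleton, not_or] at hb
      simp [redMatrix, hb.1, hb.2])
  rw [Finset.sum_pair (by simp)] at h
  simpa [redMatrix] using h

lemma hasSum_greenMatrix_zero (p : ℝ) (f : ℕ → ℝ) :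
    HasSum (fun j => greenMatrix p 0 j * f j) (f 0) := by
  have h := hasSum_single (f := fun j => greenMatrix p 0 j * f j) 0 (by
    intro b hb
    simp [greenMatrix, hb])
  simpa [greenMatrix] using h

lemma hasSum_greenMatrix_succ (p : ℝ) (f : ℕ → ℝ) (i : ℕ) :
    HasSum (fun j => greenMatrix p (i + 1) j * f j) ((1 - p) * f i + p * f (i + 1)) := by
  have h : HasSum (fun j => greenMatrix p (i + 1) j * f j)
      (∑ j ∈ {i, i + 1}, greenMatrix p (i + 1) j * f j) := hasSum_sum_of_ne_finset_zero (by
      intro b hb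
      simp only [Finset.mem_insert, Finset.mem_singleton, not_or] at hb
      simp [greenMatrix, hb.1, hb.2])
  rw [Finset.sum_pair (by simp)] at h
  simpa [greenMatrix] using h

lemma infMul_redMatrix (p : ℝ) (X : Matrix ℕ ℕ ℝ) (i k : ℕ) :
    infMul (redMatrix p) X i k = p * X (i + 1) k + (1 - p) * X i k :=
  (hasSum_redMatrix p (fun j => X j k) i).tsum_eq

lemma infMul_greenMatrix_zero (p : ℝ) (X : Matrix ℕ ℕ ℝ) (k : ℕ) :
    infMul (greenMatrix p) X 0 k = X 0 k :=
  (hasSum_greenMatrix_zero p (fun j => X j k)).tsum_eq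

lemma infMul_greenMatrix_succ (p : ℝ) (X : Matrix ℕ ℕ ℝ) (i k : ℕ) :
    infMul (greenMatrix p) X (i + 1) k = (1 - p) * X i k + p * X (i + 1) k :=
  (hasSum_greenMatrix_succ p (fun j => X j k) i).tsum_eq

/-- Nonnegative entries and row sums equal to one. -/
def IsStochastic (M : Matrix ℕ ℕ ℝ) : Prop :=
  (∀ i k, 0 ≤ M i k) ∧ ∀ i, HasSum (M i) 1

lemma isStochastic_greenMatrix (h0 : 0 ≤ p) (h1 : p ≤ 1) : IsStochastic (greenMatrix p) := by
  refine ⟨fun i k => ?_, fun i => ?_⟩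
  · unfold greenMatrix
    have : 0 ≤ 1 - p := by linarith
    split_ifs <;> first | assumption | norm_num
  · cases i with
    | zero => simpa using hasSum_greenMatrix_zero p 1
    | succ i => simpa using hasSum_greenMatrix_succ p 1 i

lemma IsStochastic.redMatrix_mul (h0 : 0 ≤ p) (h1 : p ≤ 1) {X : Matrix ℕ ℕ ℝ}
    (hX : IsStochastic X) : IsStochastic (infMul (redMatrix p) X) := by
  have : 0 ≤ 1 - p := by linarith
  refine ⟨fun i k => ?_, fun i => ?_⟩
  · rw [infMul_redMatrix]
    have := hX.1 (i + 1) k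
    have := hX.1 i k
    positivity
  · have h := ((hX.2 (i + 1)).mul_left p).add ((hX.2 i).mul_left (1 - p))
    rw [show infMul (redMatrix p) X i = _ from funext fun k => infMul_redMatrix p X i k]
    simpa using h

lemma IsStochastic.greenMatrix_mul (h0 : 0 ≤ p) (h1 : p ≤ 1) {X : Matrix ℕ ℕ ℝ}
    (hX : IsStochastic X) : IsStochastic (infMul (greenMatrix p) X) := by
  have : 0 ≤ 1 - p := by linarith
  refine ⟨fun i k => ?_, fun i => ?_⟩
  · cases i with
    | zero => rw [infMul_greenMatrix_zero]; exact hX.1 0 k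
    | succ i =>
      rw [infMul_greenMatrix_succ]
      have := hX.1 (i + 1) k
      have := hX.1 i k
      positivity
  · cases i with
    | zero =>
      rw [show infMul (greenMatrix p) X 0 = _ from funext fun k => infMul_greenMatrix_zero p X k]
      exact hX.2 0
    | succ i =>
      have h := ((hX.2 i).mul_left (1 - p)).add ((hX.2 (i + 1)).mul_left p)
      rw [show infMul (greenMatrix p) X (i + 1) = _ from
        funext fun k => infMul_greenMatrix_succ p X i k]
      simpa using h

lemma isStochastic_cycleMatrix (h0 : 0 ≤ p) (h1 : p ≤ 1) : IsStochastic (cycleMatrix p) := by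
  have hV := isStochastic_greenMatrix h0 h1
  exact ((((hV.greenMatrix_mul h0 h1).greenMatrix_mul h0 h1).redMatrix_mul h0 h1).redMatrix_mul
    h0 h1).redMatrix_mul h0 h1

/-- The cube of the green matrix away from column zero. -/
lemma greenMatrix_cube (p : ℝ) (m k : ℕ) :
    infMul (greenMatrix p) (infMul (greenMatrix p) (greenMatrix p)) m (k + 1) =
      if m = k + 1 then p ^ 3 else if m = k + 2 then 3 * p ^ 2 * (1 - p)
      else if m = k + 3 then 3 * p * (1 - p) ^ 2 else if m = k + 4 then (1 - p) ^ 3 else 0 := by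
  -- State 0 is absorbing for the green steps, so a path ending at k + 1 never felt the barrier and
  -- carries the free binomial weight.
  rcases m with _ | _ | _ | m
  · simp [infMul_greenMatrix_zero, greenMatrix]
  · simp only [zero_add, infMul_greenMatrix_zero, infMul_greenMatrix_succ, greenMatrix]
    grind
  · simp only [zero_add, infMul_greenMatrix_succ, greenMatrix]
    grind
  · simp only [infMul_greenMatrix_succ, greenMatrix]
    grind

/-- The cycle matrix away from column zero, with rows shifted by two. -/
lemma cycleMatrix_succ (p : ℝ) (i k : ℕ) :
    cycleMatrix p i (k + 1) =
      if i + 2 = k then p ^ 6 else if i + 1 = k then 6 * p ^ 5 * (1 - p)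
      else if i = k then 15 * p ^ 4 * (1 - p) ^ 2
      else if i = k + 1 then 20 * p ^ 3 * (1 - p) ^ 3
      else if i = k + 2 then 15 * p ^ 2 * (1 - p) ^ 4
      else if i = k + 3 then 6 * p * (1 - p) ^ 5
      else if i = k + 4 then (1 - p) ^ 6 else 0 := by
  simp only [cycleMatrix, infMul_redMatrix, greenMatrix_cube]
  have hcases : k = i + 2 ∨ k = i + 1 ∨ k = i ∨ i = k + 1 ∨ i = k + 2 ∨ i = k + 3 ∨ i = k + 4 ∨
      (i + 2 < k ∨ k + 4 < i) := by omega
  rcases hcases with h | h | h | h | h | h | h | h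
  iterate 7
    · subst h
      simp [add_assoc]
      ring
  · have hf : ∀ m l : ℕ, m ≤ 3 → 1 ≤ l → l ≤ 4 → ¬ (i + m = k + l) := by omega
    grind

end Matrices

/-! ### Conservation of mass under stochastic matrices. -/

section Conservation

/-- A stochastic matrix preserves the total mass of a summable sequence. -/
lemma IsStochastic.hasSum_apply {M : Matrix ℕ ℕ ℝ} (hM : IsStochastic M) {f : ℕ → ℝ}
    (hf : Summable fun j => |f j|) :
    HasSum (fun k => ∑' j, f j * M j k) (∑' j, f j) := by
  have hs : Summable fun z : ℕ × ℕ => f z.1 * M z.1 z.2 := by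
    refine .of_abs ?_
    rw [summable_prod_of_nonneg fun _ => abs_nonneg _]
    have e : ∀ j, (fun k => |f j * M j k|) = fun k => |f j| * M j k := fun j => by
      ext k; rw [abs_mul, abs_of_nonneg (hM.1 j k)]
    simp only [e]
    refine ⟨fun j => (hM.2 j).summable.mul_left _, ?_⟩
    simpa only [tsum_mul_left, (hM.2 _).tsum_eq, mul_one] using hf
  have h1 : ∑' z : ℕ × ℕ, f z.1 * M z.1 z.2 = ∑' j, f j := by
    rw [hs.tsum_prod]
    simp only [tsum_mul_left, (hM.2 _).tsum_eq, mul_one]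
  have hs' : Summable fun z : ℕ × ℕ => f z.2 * M z.2 z.1 := hs.prod_symm
  have h2 : ∑' z : ℕ × ℕ, f z.2 * M z.2 z.1 = ∑' j, f j := by
    rw [← h1]
    exact (Equiv.prodComm ℕ ℕ).tsum_eq (fun z : ℕ × ℕ => f z.1 * M z.1 z.2)
  rw [← h2]
  exact hs'.hasSum.prod_fiberwise fun k => (hs'.prod_factor k).hasSum

lemma IsStochastic.summable_mul {M : Matrix ℕ ℕ ℝ} (hM : IsStochastic M) {f : ℕ → ℝ}
    (hf : Summable fun j => |f j|) (k : ℕ) : Summable fun j => f j * M j k := by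
  refine .of_norm_bounded hf fun j => ?_
  rw [Real.norm_eq_abs, abs_mul, abs_of_nonneg (hM.1 j k)]
  have h1 : M j k ≤ 1 := le_hasSum (hM.2 j) k fun i _ => hM.1 j i
  exact mul_le_of_le_one_right (abs_nonneg _) h1

/-- Invariance at the positive states implies invariance at zero. -/
lemma IsStochastic.invariant_of_succ {M : Matrix ℕ ℕ ℝ} (hM : IsStochastic M) {f : ℕ → ℝ}
    (hf : Summable fun j => |f j|)
    (h : ∀ k, HasSum (fun j => f j * M j (k + 1)) (f (k + 1))) (k : ℕ) :
    HasSum (fun j => f j * M j k) (f k) := by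
  cases k with
  | succ k => exact h k
  | zero =>
    have h1 := hM.hasSum_apply hf
    -- The image of f and f itself have the same total and agree at all positive states, so they
    -- also agree at 0.
    have h2 := (hasSum_nat_add_iff' 1).2 h1
    have h3 := (hasSum_nat_add_iff' 1).2 hf.of_abs.hasSum
    simp only [(h _).tsum_eq] at h2
    have h4 := h2.unique h3
    simp only [Finset.sum_range_one] at h4
    have h5 : ∑' j, f j * M j 0 = f 0 := by linarith
    rw [← h5]
    exact (hM.summable_mul hf 0).hasSum

/-- The absolute value of a summable invariant sequence is invariant. -/
lemma IsStochastic.abs_invariant {M : Matrix ℕ ℕ ℝ} (hM : IsStochastic M) {f : ℕ → ℝ}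
    (hf : Summable fun j => |f j|) (h : ∀ k, HasSum (fun j => f j * M j k) (f k)) (k : ℕ) :
    HasSum (fun j => |f j| * M j k) |f k| := by
  have hf' : Summable fun j => |(fun j => |f j|) j| := by simpa using hf
  have h1 := hM.hasSum_apply hf'
  have hle : ∀ k, |f k| ≤ ∑' j, |f j| * M j k := by
    intro k
    have e : ∀ j, |f j * M j k| = |f j| * M j k := fun j => by
      rw [abs_mul, abs_of_nonneg (hM.1 j k)]
    have hs := hM.summable_mul hf' k
    rw [← (h k).tsum_eq]
    have := norm_tsum_le_tsum_norm (f := fun j => f j * M j k)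
      (by simpa only [Real.norm_eq_abs, e] using hs)
    simpa only [Real.norm_eq_abs, e] using this
  -- The triangle inequality gives |f| ≤ |f|M entrywise; equality of the total masses turns it into
  -- equality everywhere.
  have h2 := h1.sub hf.hasSum
  rw [sub_self] at h2
  have h3 := (hasSum_zero_iff_of_nonneg fun k => sub_nonneg.2 (hle k)).1 h2
  have h4 := congrFun h3 k
  simp only [Pi.zero_apply, sub_eq_zero] at h4
  rw [← h4]
  exact (hM.summable_mul hf' k).hasSum

end Conservation

/-! ### Linear recurrences and their null solutions. -/

section Recurrences

/-- The difference operator `E - x` on sequences, `E` being the shift. -/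
def diff (x : ℂ) (f : ℕ → ℂ) (n : ℕ) : ℂ := f (n + 1) - x * f n

lemma diff_comm (x y : ℂ) (f : ℕ → ℂ) : diff x (diff y f) = diff y (diff x f) := by
  ext n; simp only [diff]; ring

lemma tendsto_diff (x : ℂ) {f : ℕ → ℂ} (hf : Tendsto f atTop (𝓝 0)) :
    Tendsto (diff x f) atTop (𝓝 0) := by
  have h := ((tendsto_add_atTop_iff_nat 1).2 hf).sub (hf.const_mul x)
  rw [mul_zero, sub_zero] at h
  exact h

/-- A null sequence with `f (n + 1) = y f n` and `1 ≤ ‖y‖` vanishes. -/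
lemma eq_zero_of_diff_eq_zero {y : ℂ} (hy : 1 ≤ ‖y‖) {f : ℕ → ℂ} (hf : Tendsto f atTop (𝓝 0))
    (h : diff y f = 0) : f = 0 := by
  ext n
  have hmono : Monotone fun n => ‖f n‖ := monotone_nat_of_le_succ fun n => by
    have h1 : f (n + 1) = y * f n := sub_eq_zero.1 (congrFun h n)
    rw [h1, norm_mul]
    exact le_mul_of_one_le_left (norm_nonneg _) hy
  have h0 : Tendsto (fun n => ‖f n‖) atTop (𝓝 0) := by simpa using hf.norm
  exact norm_le_zero_iff.1 (hmono.ge_of_tendsto h0 n)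

/-- The recurrence `(P + Q E) ^ 6 F = E ^ 3 F`. -/
def IsBinomialRec (P Q : ℂ) (F : ℕ → ℂ) : Prop :=
  ∀ n, P ^ 6 * F n + 6 * P ^ 5 * Q * F (n + 1) + 15 * P ^ 4 * Q ^ 2 * F (n + 2)
    + 20 * P ^ 3 * Q ^ 3 * F (n + 3) + 15 * P ^ 2 * Q ^ 4 * F (n + 4)
    + 6 * P * Q ^ 5 * F (n + 5) + Q ^ 6 * F (n + 6) = F (n + 3)

/-- Z³ − E³ with Z = (P + QE)² factors as the product of Z − vE over v = 1, w, w². Each factor is Q²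
times a monic quadratic in E, with roots x and y of the prescribed sum and product. -/
lemma IsBinomialRec.diff_eq_zero {P Q w : ℂ} {F : ℕ → ℂ} (hF : IsBinomialRec P Q F)
    (hQ : Q ≠ 0) (hw : 1 + w + w ^ 2 = 0) {x₀ x₁ x₂ y₀ y₁ y₂ : ℂ}
    (hs₀ : x₀ + y₀ = 1 / Q ^ 2 - 2 * (P / Q)) (hs₁ : x₁ + y₁ = w / Q ^ 2 - 2 * (P / Q))
    (hs₂ : x₂ + y₂ = w ^ 2 / Q ^ 2 - 2 * (P / Q)) (hm₀ : x₀ * y₀ = (P / Q) ^ 2)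
    (hm₁ : x₁ * y₁ = (P / Q) ^ 2) (hm₂ : x₂ * y₂ = (P / Q) ^ 2) :
    diff y₀ (diff y₁ (diff y₂ (diff x₀ (diff x₁ (diff x₂ F))))) = 0 := by
  have hquad : ∀ x y v : ℂ, x + y = v / Q ^ 2 - 2 * (P / Q) → x * y = (P / Q) ^ 2 →
      ∀ f n, diff y (diff x f) n
        = f (n + 2) - (v / Q ^ 2 - 2 * (P / Q)) * f (n + 1) + (P / Q) ^ 2 * f n := by
    intro x y v h1 h2 f n
    rw [← h1, ← h2]
    simp only [diff]
    ring
  rw [diff_comm y₂ x₀, diff_comm y₂ x₁, diff_comm y₁ x₀]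
  ext n
  rw [hquad x₀ y₀ 1 hs₀ hm₀]
  simp only [hquad x₁ y₁ w hs₁ hm₁, hquad x₂ y₂ (w ^ 2) hs₂ hm₂]
  have h := hF n
  simp only [add_assoc, Nat.reduceAdd] at h ⊢
  generalize F n = f0 at *
  generalize F (n + 1) = f1 at *
  generalize F (n + 2) = f2 at *
  generalize F (n + 3) = f3 at *
  generalize F (n + 4) = f4 at *
  generalize F (n + 5) = f5 at *
  generalize F (n + 6) = f6 at *
  have hw3 : w ^ 3 = 1 := by linear_combination (w - 1) * hw
  -- Scaling by r = P/Q and u = 1/Q² makes the identity polynomial.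
  obtain ⟨r, rfl⟩ : ∃ r, P = r * Q := ⟨P / Q, by field_simp⟩
  obtain ⟨u, hu⟩ : ∃ u, u = 1 / Q ^ 2 := ⟨_, rfl⟩
  have hu3 : u ^ 3 * Q ^ 6 = 1 := by rw [hu]; field_simp
  have h' : r ^ 6 * f0 + 6 * r ^ 5 * f1 + 15 * r ^ 4 * f2 + 20 * r ^ 3 * f3 + 15 * r ^ 2 * f4
      + 6 * r * f5 + f6 = u ^ 3 * f3 := by
    linear_combination u ^ 3 * h - (r ^ 6 * f0 + 6 * r ^ 5 * f1 + 15 * r ^ 4 * f2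
      + 20 * r ^ 3 * f3 + 15 * r ^ 2 * f4 + 6 * r * f5 + f6) * hu3
  rw [mul_div_cancel_right₀ r hQ, div_eq_mul_one_div w, div_eq_mul_one_div (w ^ 2), ← hu]
  simp only [Pi.zero_apply]
  linear_combination h' - u * (f5 + 4 * r * f4 + 6 * r ^ 2 * f3 + 4 * r ^ 3 * f2 + r ^ 4 * f1) * hw
    + u ^ 2 * w * (f4 + 2 * r * f3 + r ^ 2 * f2) * hw - u ^ 3 * f3 * hw3

variable (x₀ x₁ x₂ : ℂ)

/-- The solution of the third order recurrence with characteristic roots `x₀, x₁, x₂` and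
initial values `0, 0, 1`. -/
noncomputable def fundSeq (n : ℕ) : ℂ :=
  x₀ ^ n / ((x₀ - x₁) * (x₀ - x₂)) + x₁ ^ n / ((x₁ - x₀) * (x₁ - x₂))
    + x₂ ^ n / ((x₂ - x₀) * (x₂ - x₁))

variable {x₀ x₁ x₂}

lemma fundSeq_values (h01 : x₀ - x₁ ≠ 0) (h02 : x₀ - x₂ ≠ 0) (h12 : x₁ - x₂ ≠ 0) :
    fundSeq x₀ x₁ x₂ 0 = 0 ∧ fundSeq x₀ x₁ x₂ 1 = 0 ∧ fundSeq x₀ x₁ x₂ 2 = 1 := by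
  have h10 : x₁ - x₀ ≠ 0 := by rwa [← neg_sub, neg_ne_zero]
  have h20 : x₂ - x₀ ≠ 0 := by rwa [← neg_sub, neg_ne_zero]
  have h21 : x₂ - x₁ ≠ 0 := by rwa [← neg_sub, neg_ne_zero]
  simp only [fundSeq]
  refine ⟨?_, ?_, ?_⟩ <;> field_simp <;> ring

lemma diff_fundSeq : diff x₀ (diff x₁ (diff x₂ (fundSeq x₀ x₁ x₂))) = 0 := by
  ext n
  simp only [diff, fundSeq, Pi.zero_apply]
  ring

lemma isBinomialRec_fundSeq {P Q : ℂ} (h0 : (P + Q * x₀) ^ 6 = x₀ ^ 3)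
    (h1 : (P + Q * x₁) ^ 6 = x₁ ^ 3) (h2 : (P + Q * x₂) ^ 6 = x₂ ^ 3) :
    IsBinomialRec P Q (fundSeq x₀ x₁ x₂) := by
  intro n
  simp only [fundSeq]
  linear_combination x₀ ^ n / ((x₀ - x₁) * (x₀ - x₂)) * h0
    + x₁ ^ n / ((x₁ - x₀) * (x₁ - x₂)) * h1 + x₂ ^ n / ((x₂ - x₀) * (x₂ - x₁)) * h2

/-- A third order recurrence is determined by three consecutive values, and the first two vanish. -/
lemma eq_smul_fundSeq (h01 : x₀ - x₁ ≠ 0) (h02 : x₀ - x₂ ≠ 0) (h12 : x₁ - x₂ ≠ 0)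
    {F : ℕ → ℂ} (hF : diff x₀ (diff x₁ (diff x₂ F)) = 0) (hF0 : F 0 = 0) (hF1 : F 1 = 0) (n : ℕ) :
    F n = F 2 * fundSeq x₀ x₁ x₂ n := by
  obtain ⟨e0, e1, e2⟩ := fundSeq_values h01 h02 h12
  suffices h : F n = F 2 * fundSeq x₀ x₁ x₂ n ∧ F (n + 1) = F 2 * fundSeq x₀ x₁ x₂ (n + 1) ∧
      F (n + 2) = F 2 * fundSeq x₀ x₁ x₂ (n + 2) from h.1
  induction n with
  | zero => simp [hF0, hF1, e0, e1, e2]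
  | succ n ih =>
    obtain ⟨i0, i1, i2⟩ := ih
    refine ⟨i1, i2, ?_⟩
    have k1 := congrFun hF n
    have k2 := congrFun (diff_fundSeq (x₀ := x₀) (x₁ := x₁) (x₂ := x₂)) n
    simp only [diff, Pi.zero_apply, add_assoc, Nat.reduceAdd] at k1 k2 ⊢
    linear_combination k1 - F 2 * k2 + (x₀ + x₁ + x₂) * i2 - (x₀ * x₁ + x₀ * x₂ + x₁ * x₂) * i1
      + x₀ * x₁ * x₂ * i0

lemma hasSum_fundSeq (h01 : x₀ - x₁ ≠ 0) (h02 : x₀ - x₂ ≠ 0) (h12 : x₁ - x₂ ≠ 0)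
    (h0 : ‖x₀‖ < 1) (h1 : ‖x₁‖ < 1) (h2 : ‖x₂‖ < 1) :
    HasSum (fun j => fundSeq x₀ x₁ x₂ (j + 2)) (1 / ((1 - x₀) * (1 - x₁) * (1 - x₂))) := by
  have h10 : x₁ - x₀ ≠ 0 := by rwa [← neg_sub, neg_ne_zero]
  have h20 : x₂ - x₀ ≠ 0 := by rwa [← neg_sub, neg_ne_zero]
  have h21 : x₂ - x₁ ≠ 0 := by rwa [← neg_sub, neg_ne_zero]
  have ne : ∀ x : ℂ, ‖x‖ < 1 → 1 - x ≠ 0 := fun x hx h => by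
    rw [sub_eq_zero] at h
    simp [← h] at hx
  have n0 := ne _ h0
  have n1 := ne _ h1
  have n2 := ne _ h2
  have h := (((hasSum_geometric_of_norm_lt_one h0).mul_left (x₀ ^ 2 / ((x₀ - x₁) * (x₀ - x₂)))).add
    ((hasSum_geometric_of_norm_lt_one h1).mul_left (x₁ ^ 2 / ((x₁ - x₀) * (x₁ - x₂))))).add
    ((hasSum_geometric_of_norm_lt_one h2).mul_left (x₂ ^ 2 / ((x₂ - x₀) * (x₂ - x₁))))
  convert! h using 1
  · ext j
    simp only [fundSeq]
    ring
  · field_simp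
    ring

lemma tendsto_fundSeq_div (hx : x₀ ≠ 0) (h1 : ‖x₁‖ < ‖x₀‖) (h2 : ‖x₂‖ < ‖x₀‖) :
    Tendsto (fun j => fundSeq x₀ x₁ x₂ (j + 2) / x₀ ^ j) atTop
      (𝓝 (x₀ ^ 2 / ((x₀ - x₁) * (x₀ - x₂)))) := by
  have hn : 0 < ‖x₀‖ := norm_pos_iff.2 hx
  have key : ∀ x : ℂ, ‖x‖ < ‖x₀‖ → Tendsto (fun j : ℕ => (x / x₀) ^ j) atTop (𝓝 0) := by
    intro x h
    refine tendsto_pow_atTop_nhds_zero_of_norm_lt_one ?_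
    rwa [norm_div, div_lt_one hn]
  have h := ((tendsto_const_nhds (x := x₀ ^ 2 / ((x₀ - x₁) * (x₀ - x₂)))).add
    ((key _ h1).const_mul (x₁ ^ 2 / ((x₁ - x₀) * (x₁ - x₂))))).add
    ((key _ h2).const_mul (x₂ ^ 2 / ((x₂ - x₀) * (x₂ - x₁))))
  simp only [mul_zero, add_zero] at h
  refine h.congr fun j => ?_
  have := pow_ne_zero j hx
  simp only [fundSeq, div_pow]
  field_simp
  ring

end Recurrences

/-! ### Invariance as a recurrence. -/

section Stationary

/-- The sequence `0, 0, f 0, f 1, …`. -/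
def shiftTwo (f : ℕ → ℝ) : ℕ → ℝ
  | 0 => 0
  | 1 => 0
  | n + 2 => f n

/-- The two leading zeros play the part of empty states −2 and −1. With them the same seven-term
formula holds for every column k + 1, including those near the barrier. -/
lemma hasSum_cycleMatrix_succ (p : ℝ) (f : ℕ → ℝ) (k : ℕ) :
    HasSum (fun j => f j * cycleMatrix p j (k + 1))
      (p ^ 6 * shiftTwo f k + 6 * p ^ 5 * (1 - p) * shiftTwo f (k + 1)
        + 15 * p ^ 4 * (1 - p) ^ 2 * shiftTwo f (k + 2)
        + 20 * p ^ 3 * (1 - p) ^ 3 * shiftTwo f (k + 3)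
        + 15 * p ^ 2 * (1 - p) ^ 4 * shiftTwo f (k + 4)
        + 6 * p * (1 - p) ^ 5 * shiftTwo f (k + 5) + (1 - p) ^ 6 * shiftTwo f (k + 6)) := by
  set A : ℕ → ℝ := fun n => if n = k then p ^ 6 else if n = k + 1 then 6 * p ^ 5 * (1 - p)
      else if n = k + 2 then 15 * p ^ 4 * (1 - p) ^ 2
      else if n = k + 3 then 20 * p ^ 3 * (1 - p) ^ 3
      else if n = k + 4 then 15 * p ^ 2 * (1 - p) ^ 4
      else if n = k + 5 then 6 * p * (1 - p) ^ 5
      else if n = k + 6 then (1 - p) ^ 6 else 0 with hA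
  have hM : ∀ j, cycleMatrix p j (k + 1) = A (j + 2) := by
    intro j
    rw [cycleMatrix_succ]
    grind
  have h : HasSum (fun n => shiftTwo f n * A n)
      (∑ n ∈ (Finset.range 7).map (addLeftEmbedding k), shiftTwo f n * A n) :=
    hasSum_sum_of_ne_finset_zero fun n hn => by
      have : ∀ i < 7, n ≠ k + i := fun i hi h => hn <| by
        simp only [Finset.mem_map, Finset.mem_range, addLeftEmbedding_apply]
        exact ⟨i, hi, h.symm⟩
      have h0 := this 0 (by norm_num)
      have h1 := this 1 (by norm_num)
      have h2 := this 2 (by norm_num)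
      have h3 := this 3 (by norm_num)
      have h4 := this 4 (by norm_num)
      have h5 := this 5 (by norm_num)
      have h6 := this 6 (by norm_num)
      rw [add_zero] at h0
      simp [hA, h0, h1, h2, h3, h4, h5, h6]
  have h2 := (hasSum_nat_add_iff' 2).2 h
  simp only [Finset.sum_map, addLeftEmbedding_apply, Finset.sum_range_succ,
    Finset.sum_range_zero, show shiftTwo f 0 = 0 from rfl, show shiftTwo f 1 = 0 from rfl, zero_mul, add_zero, zero_add, sub_zero] at h2
  simp only [hM]
  have h3 : HasSum (fun j => f j * A (j + 2)) _ := h2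
  have a0 : A k = p ^ 6 := by simp [hA]
  have a1 : A (k + 1) = 6 * p ^ 5 * (1 - p) := by simp [hA]
  have a2 : A (k + 2) = 15 * p ^ 4 * (1 - p) ^ 2 := by simp [hA]
  have a3 : A (k + 3) = 20 * p ^ 3 * (1 - p) ^ 3 := by simp [hA]
  have a4 : A (k + 4) = 15 * p ^ 2 * (1 - p) ^ 4 := by simp [hA]
  have a5 : A (k + 5) = 6 * p * (1 - p) ^ 5 := by simp [hA]
  have a6 : A (k + 6) = (1 - p) ^ 6 := by simp [hA]
  rw [a0, a1, a2, a3, a4, a5, a6] at h3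
  simpa only [mul_comm (shiftTwo f _)] using h3

lemma isBinomialRec_shiftTwo {p : ℝ} {f : ℕ → ℝ}
    (h : ∀ k, HasSum (fun j => f j * cycleMatrix p j (k + 1)) (f (k + 1))) :
    IsBinomialRec p (1 - p) (fun n => (shiftTwo f n : ℂ)) := by
  intro n
  have h1 := (hasSum_cycleMatrix_succ p f n).unique (h n)
  rw [show f (n + 1) = shiftTwo f (n + 3) from rfl] at h1
  beta_reduce
  exact_mod_cast h1

end Stationary

/-! ### The characteristic roots. -/

/-- The decaying characteristic root attached to a square root `s` of `1 - 4 p q ω`. -/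
noncomputable def decayRoot (P Q s : ℂ) : ℂ := P / Q * ((1 - s) / (1 + s))

/-- The partner of `decayRoot`. -/
noncomputable def growRoot (P Q s : ℂ) : ℂ := P / Q * ((1 + s) / (1 - s))

section CharacteristicRoots
variable {P Q s w v : ℂ}

lemma one_sub_ne_zero (hP : P ≠ 0) (hQ : Q ≠ 0) (hs : s ^ 2 = 1 - 4 * (w * (P * Q)))
    (hv : v * w = 1) : 1 - s ≠ 0 := by
  intro h
  have h1 : 4 * (w * (P * Q)) = 0 := by linear_combination hs + (1 + s) * h
  have hw : w ≠ 0 := right_ne_zero_of_mul_eq_one hv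
  simp [hP, hQ, hw] at h1

lemma decayRoot_add_growRoot (hP : P ≠ 0) (hQ : Q ≠ 0) (h1 : 1 + s ≠ 0)
    (hs : s ^ 2 = 1 - 4 * (w * (P * Q))) (hv : v * w = 1) :
    decayRoot P Q s + growRoot P Q s = v / Q ^ 2 - 2 * (P / Q) := by
  have h2 := one_sub_ne_zero hP hQ hs hv
  simp only [decayRoot, growRoot]
  field_simp
  linear_combination v * hs - 4 * P * Q * hv

lemma decayRoot_mul_growRoot (hP : P ≠ 0) (hQ : Q ≠ 0) (h1 : 1 + s ≠ 0)
    (hs : s ^ 2 = 1 - 4 * (w * (P * Q))) (hv : v * w = 1) :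
    decayRoot P Q s * growRoot P Q s = (P / Q) ^ 2 := by
  have h2 := one_sub_ne_zero hP hQ hs hv
  simp only [decayRoot, growRoot]
  field_simp

/-- Sum and product of the pair say that X solves (P + QX)² = vX; cubing removes v. -/
lemma decayRoot_pow (hP : P ≠ 0) (hQ : Q ≠ 0) (h1 : 1 + s ≠ 0)
    (hs : s ^ 2 = 1 - 4 * (w * (P * Q))) (hv : v * w = 1) (hv3 : v ^ 3 = 1) :
    (P + Q * decayRoot P Q s) ^ 6 = decayRoot P Q s ^ 3 := by
  have ha := decayRoot_add_growRoot hP hQ h1 hs hv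
  have hm := decayRoot_mul_growRoot hP hQ h1 hs hv
  set X := decayRoot P Q s
  set Y := growRoot P Q s
  have h : (P + Q * X) ^ 2 = v * X := by
    have h3 : X * (v / Q ^ 2 - 2 * (P / Q)) - X ^ 2 = (P / Q) ^ 2 := by
      rw [← ha, ← hm]; ring
    field_simp at h3
    linear_combination -h3
  calc (P + Q * X) ^ 6 = ((P + Q * X) ^ 2) ^ 3 := by ring
    _ = X ^ 3 := by rw [h, mul_pow, hv3, one_mul]

end CharacteristicRoots

/-- From |1 − s||1 + s| = 4pq and |1 + s| > 2 one gets |1 − s| < 2pq, so the quotient of the two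
moduli is below pq < p/q. -/
lemma norm_decayRoot_lt {p : ℝ} (hp : 0 < p) (hp1 : p < 1 / 2) {s w : ℂ} (hre : 1 < s.re)
    (hs : s ^ 2 = 1 - 4 * (w * (p * (1 - p)))) (hw : ‖w‖ = 1) :
    ‖decayRoot p (1 - p) s‖ < (p / (1 - p)) ^ 2 ∧ 1 ≤ ‖growRoot p (1 - p) s‖ := by
  have hq : 0 < 1 - p := by linarith
  have hPn : ‖(p : ℂ)‖ = p := by rw [Complex.norm_real, Real.norm_of_nonneg hp.le]
  have hQn : ‖(1 - p : ℂ)‖ = 1 - p := by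
    rw [← Complex.ofReal_one, ← Complex.ofReal_sub, Complex.norm_real, Real.norm_of_nonneg hq.le]
  have hbig : 2 < ‖1 + s‖ := by
    have := Complex.re_le_norm (1 + s)
    rw [Complex.add_re, Complex.one_re] at this
    linarith
  have hprod : ‖1 - s‖ * ‖1 + s‖ = 4 * (p * (1 - p)) := by
    rw [← norm_mul, show (1 - s) * (1 + s) = 4 * (w * (p * (1 - p))) by linear_combination -hs,
      norm_mul, norm_mul, norm_mul, hw, hPn, hQn]
    norm_num
  have hpos : 0 < ‖1 - s‖ := by
    refine (norm_nonneg _).lt_of_ne fun h => ?_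
    rw [← h, zero_mul] at hprod
    have := mul_pos hp hq
    linarith
  have hsmall : ‖1 - s‖ < 2 * (p * (1 - p)) := by nlinarith
  have hr : 0 < p / (1 - p) := div_pos hp hq
  have hratio : ‖1 - s‖ / ‖1 + s‖ < p / (1 - p) := by
    rw [div_lt_div_iff₀ (by linarith) hq]
    nlinarith
  simp only [decayRoot, growRoot, norm_mul, norm_div, hPn, hQn]
  refine ⟨by rw [sq]; gcongr, ?_⟩
  rw [div_mul_div_comm, one_le_div (by positivity)]
  rw [div_lt_div_iff₀ (by linarith) hq] at hratio
  linarith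

/-! ### The stationary distribution and its tail. -/

section Stationary
variable {p : ℝ}

/-- The three decaying characteristic roots satisfy all the requirements. -/
lemma characteristicRoots (hp : 0 < p) (hp1 : p < 1 / 2) {x₁ x₂ : ℂ}
    (hx₁ : x₁ = decayRoot p (1 - p) (root p)) (hx₂ : x₂ = decayRoot p (1 - p) (rootConj p)) :
    ‖x₁‖ < (p / (1 - p)) ^ 2 ∧ ‖x₂‖ < (p / (1 - p)) ^ 2 ∧ x₁ - x₂ ≠ 0 ∧
    (∀ F, IsBinomialRec p (1 - p) F → Tendsto F atTop (𝓝 0) →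
      diff ((p / (1 - p)) ^ 2) (diff x₁ (diff x₂ F)) = 0) ∧
    IsBinomialRec p (1 - p) (fundSeq ((p / (1 - p)) ^ 2) x₁ x₂) := by
  subst hx₁ hx₂
  have ha := one_lt_rootRe hp hp1
  have hP : (p : ℂ) ≠ 0 := Complex.ofReal_ne_zero.2 hp.ne'
  have hQ : (1 - p : ℂ) ≠ 0 := by
    rw [← Complex.ofReal_one, ← Complex.ofReal_sub]
    exact Complex.ofReal_ne_zero.2 (by linarith)
  have h1 := ne_zero_of_re_pos (s := root p) (by rw [root_re]; linarith)
  have h2 := ne_zero_of_re_pos (s := rootConj p) (by rw [rootConj_re]; linarith)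
  obtain ⟨hs1, hs2⟩ := root_sq hp hp1
  have hw := cubeRoot_eq
  have hw3 : cubeRoot ^ 3 = 1 := by linear_combination (cubeRoot - 1) * hw
  have hwn : ‖cubeRoot‖ = 1 := by
    have : ‖cubeRoot‖ ^ 3 = 1 := by rw [← norm_pow, hw3, norm_one]
    exact (pow_eq_one_iff_of_nonneg (norm_nonneg _) (by norm_num)).1 this
  have hv1 : cubeRoot ^ 2 * cubeRoot = 1 := by linear_combination hw3
  have hv2 : cubeRoot * cubeRoot ^ 2 = 1 := by linear_combination hw3
  have hn1 := norm_decayRoot_lt hp hp1 (by rw [root_re]; exact ha) hs1 hwn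
  have hn2 := norm_decayRoot_lt hp hp1 (by rw [rootConj_re]; exact ha) hs2
    (by rw [norm_pow, hwn, one_pow])
  refine ⟨hn1.1, hn2.1, ?_, ?_, ?_⟩
  -- Equal decaying roots would force the two conjugate square roots to coincide, contradicting
  -- their nonzero imaginary part.
  · intro h
    rw [decayRoot, decayRoot, ← mul_sub] at h
    have h3 := (mul_eq_zero.1 h).resolve_left (div_ne_zero hP hQ)
    have h1' := h1.2
    have h2' := h2.2
    field_simp at h3
    have h4 : root p = rootConj p := by linear_combination -h3 / 2
    have h5 : sqrtNegThree * rootIm p = 0 := by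
      rw [root, rootConj] at h4
      linear_combination -3 / 2 * h4
    have hz : sqrtNegThree ≠ 0 := fun hz => by
      have := sqrtNegThree_sq
      rw [hz] at this
      norm_num at this
    have hc : rootIm p ≠ 0 := by
      have := rootRe_mul_rootIm hp hp1
      intro hc
      rw [hc, mul_zero] at this
      have : 0 < p * (1 - p) := mul_pos hp (by linarith)
      linarith
    exact mul_ne_zero hz (Complex.ofReal_ne_zero.2 hc) h5
  · intro F hF hF0
    -- For the cube root 1 the pair of roots is (p/q)² and 1. The quadratic with parameter ω belongs
    -- to the conjugate root, since its parameter is the inverse of the ω under the square root.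
    have h := hF.diff_eq_zero hQ hw (x₀ := (p / (1 - p)) ^ 2) (y₀ := 1) (by field_simp; ring)
      (decayRoot_add_growRoot hP hQ h2.2 hs2 hv2) (decayRoot_add_growRoot hP hQ h1.2 hs1 hv1)
      (by ring) (decayRoot_mul_growRoot hP hQ h2.2 hs2 hv2)
      (decayRoot_mul_growRoot hP hQ h1.2 hs1 hv1)
    rw [diff_comm (decayRoot p (1 - p) (rootConj p))] at h
    have t1 := tendsto_diff ((p / (1 - p) : ℂ) ^ 2) (tendsto_diff (decayRoot p (1 - p) (root p))
      (tendsto_diff (decayRoot p (1 - p) (rootConj p)) hF0))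
    have t2 := tendsto_diff (growRoot p (1 - p) (root p)) t1
    have t3 := tendsto_diff (growRoot p (1 - p) (rootConj p)) t2
    -- The factors with roots of modulus at least 1 are peeled off from the outside; each
    -- intermediate sequence is null, hence zero.
    exact eq_zero_of_diff_eq_zero hn1.2 t1
      (eq_zero_of_diff_eq_zero hn2.2 t2 (eq_zero_of_diff_eq_zero (by simp) t3 h))
  · refine isBinomialRec_fundSeq ?_ (decayRoot_pow hP hQ h1.2 hs1 hv1 (by
      rw [← pow_mul, mul_comm, pow_mul, hw3, one_pow])) (decayRoot_pow hP hQ h2.2 hs2 hv2 hw3)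
    field_simp
    ring

/-- Existence, uniqueness and geometric decay of the stationary distribution. -/
lemma exists_stationary (hp : 0 < p) (hp1 : p < 1 / 2) {x₀ x₁ x₂ : ℂ}
    (hx₀ : x₀ = (p / (1 - p)) ^ 2)
    (hx₁ : x₁ = decayRoot p (1 - p) (root p)) (hx₂ : x₂ = decayRoot p (1 - p) (rootConj p)) :
    ∃ π : ℕ → ℝ, IsStationary p π ∧ (∀ π' : ℕ → ℝ, IsStationary p π' → π' = π) ∧
      Tendsto (fun j => π j / ((p / (1 - p)) ^ 2) ^ j) atTop
        (𝓝 ((1 - x₀) * (1 - x₁) * (1 - x₂) * (x₀ ^ 2 / ((x₀ - x₁) * (x₀ - x₂)))).re) := by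
  obtain ⟨hn1, hn2, h12, hrec, hfund⟩ := characteristicRoots hp hp1 hx₁ hx₂
  rw [← hx₀] at hrec hfund
  have hq : 0 < 1 - p := by linarith
  have hr : 0 < p / (1 - p) := div_pos hp hq
  have hr1 : p / (1 - p) < 1 := by rw [div_lt_one hq]; linarith
  have hx₀r : x₀ = (((p / (1 - p)) ^ 2 : ℝ) : ℂ) := by rw [hx₀]; push_cast; ring
  have hn0 : ‖x₀‖ = (p / (1 - p)) ^ 2 := by
    rw [hx₀r, Complex.norm_real, Real.norm_of_nonneg (by positivity)]
  have hlt1 : (p / (1 - p)) ^ 2 < 1 := pow_lt_one₀ hr.le hr1 (by norm_num)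
  have h01 : x₀ - x₁ ≠ 0 := fun h => by rw [sub_eq_zero] at h; rw [← h, hn0] at hn1; linarith
  have h02 : x₀ - x₂ ≠ 0 := fun h => by rw [sub_eq_zero] at h; rw [← h, hn0] at hn2; linarith
  have hx₀0 : x₀ ≠ 0 := by rw [← norm_pos_iff, hn0]; positivity
  obtain ⟨e0, e1, e2⟩ := fundSeq_values h01 h02 h12
  have hsum := hasSum_fundSeq h01 h02 h12 (by rw [hn0]; exact hlt1) (hn1.trans hlt1)
    (hn2.trans hlt1)
  have ne : ∀ x : ℂ, ‖x‖ < 1 → 1 - x ≠ 0 := fun x hx h => by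
    rw [sub_eq_zero] at h
    simp [← h] at hx
  have hK0 : (1 - x₀) * (1 - x₁) * (1 - x₂) ≠ 0 := mul_ne_zero (mul_ne_zero
    (ne _ (by rw [hn0]; exact hlt1)) (ne _ (hn1.trans hlt1))) (ne _ (hn2.trans hlt1))
  have hlim := (tendsto_fundSeq_div hx₀0 (hn1.trans_eq hn0.symm) (hn2.trans_eq hn0.symm)).const_mul
    ((1 - x₀) * (1 - x₁) * (1 - x₂))
  set K := (1 - x₀) * (1 - x₁) * (1 - x₂)
  set H := fundSeq x₀ x₁ x₂
  have hM := isStochastic_cycleMatrix hp.le (by linarith : p ≤ 1)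
  have key : ∀ f : ℕ → ℝ, Tendsto f atTop (𝓝 0) →
      (∀ k, HasSum (fun j => f j * cycleMatrix p j k) (f k)) → ∀ j, (f j : ℂ) = f 0 * H (j + 2) := by
    intro f hf0 hf j
    have h1 := isBinomialRec_shiftTwo fun k => hf (k + 1)
    have h2 : Tendsto (fun n => (shiftTwo f n : ℂ)) atTop (𝓝 0) := by
      rw [← tendsto_add_atTop_iff_nat 2]
      have := (Complex.continuous_ofReal.tendsto 0).comp hf0
      rw [Complex.ofReal_zero] at this
      exact this
    exact eq_smul_fundSeq h01 h02 h12 (hrec _ h1 h2) (by simp [shiftTwo]) (by simp [shiftTwo])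
      (j + 2)
  have keySum : ∀ (f : ℕ → ℝ) (S : ℝ), HasSum f S →
      (∀ k, HasSum (fun j => f j * cycleMatrix p j k) (f k)) →
      ∀ j, f j = S * (K * H (j + 2)).re := by
    intro f S hS hf j
    have h1 := key f hS.summable.tendsto_atTop_zero hf
    have h2 : HasSum (fun j => (f j : ℂ)) (f 0 * (1 / K)) := by
      rw [show (fun j => (f j : ℂ)) = _ from funext h1]
      exact hsum.mul_left _
    have h3 : (S : ℂ) = f 0 * (1 / K) := (Complex.hasSum_ofReal.2 hS).unique h2
    have h4 : (f j : ℂ) = S * (K * H (j + 2)) := by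
      rw [h1 j, h3]
      field_simp
    rw [← Complex.re_ofReal_mul, ← h4, Complex.ofReal_re]
  have hπsum : HasSum (fun j => (K * H (j + 2)).re) 1 := by
    have h := Complex.hasSum_re (hsum.mul_left K)
    rw [mul_one_div_cancel hK0, Complex.one_re] at h
    exact h
  have hπinv : ∀ k, HasSum (fun j => (K * H (j + 2)).re * cycleMatrix p j k)
      (K * H (k + 2)).re := by
    -- The recurrence only covers the columns k + 1; column 0 comes from conservation of mass.
    refine hM.invariant_of_succ (f := fun j => (K * H (j + 2)).re) hπsum.summable.abs fun k => ?_
    have hsh : ∀ n, shiftTwo (fun j => (K * H (j + 2)).re) n = (K * H n).re := by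
      intro n
      rcases n with _ | _ | n
      · simp [shiftTwo, e0]
      · simp [shiftTwo, e1]
      · rfl
    have h := hasSum_cycleMatrix_succ p (fun j => (K * H (j + 2)).re) k
    simp only [hsh] at h
    have h2 := congrArg (fun z => (K * z).re) (hfund k)
    have e : ∀ h0 h1 h2 h3 h4 h5 h6 : ℂ, K * (p ^ 6 * h0 + 6 * p ^ 5 * (1 - p) * h1
        + 15 * p ^ 4 * (1 - p) ^ 2 * h2 + 20 * p ^ 3 * (1 - p) ^ 3 * h3
        + 15 * p ^ 2 * (1 - p) ^ 4 * h4 + 6 * p * (1 - p) ^ 5 * h5 + (1 - p) ^ 6 * h6)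
        = (p ^ 6 : ℝ) * (K * h0) + (6 * p ^ 5 * (1 - p) : ℝ) * (K * h1)
        + (15 * p ^ 4 * (1 - p) ^ 2 : ℝ) * (K * h2) + (20 * p ^ 3 * (1 - p) ^ 3 : ℝ) * (K * h3)
        + (15 * p ^ 2 * (1 - p) ^ 4 : ℝ) * (K * h4) + (6 * p * (1 - p) ^ 5 : ℝ) * (K * h5)
        + ((1 - p) ^ 6 : ℝ) * (K * h6) := by
      intros
      push_cast
      ring
    beta_reduce at h2
    rw [e] at h2
    simp only [Complex.add_re, Complex.re_ofReal_mul] at h2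
    rw [h2] at h
    exact h
  refine ⟨fun j => (K * H (j + 2)).re, ⟨fun j => ?_, hπsum, hπinv⟩, fun π' h' => ?_, ?_⟩
  -- The sequence |π| is also summable and invariant, so |π| = Sπ with S its total mass. As S ≥ 1, π
  -- is nonnegative.
  · have h1 := hM.abs_invariant (f := fun j => (K * H (j + 2)).re) hπsum.summable.abs hπinv
    have h2 := keySum _ _ hπsum.summable.abs.hasSum h1 j
    have h3 : 1 ≤ ∑' j, |(K * H (j + 2)).re| :=
      hasSum_le (fun j => le_abs_self _) hπsum hπsum.summable.abs.hasSum
    have h4 := abs_nonneg (K * H (j + 2)).re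
    rw [h2] at h4
    exact nonneg_of_mul_nonneg_right h4 (by linarith)
  · ext j
    simpa using keySum π' 1 h'.hasSum_one h'.invariant j
  · have h := (Complex.continuous_re.tendsto _).comp hlim
    refine h.congr fun j => ?_
    have e : x₀ ^ j = ((((p / (1 - p)) ^ 2) ^ j : ℝ) : ℂ) := by rw [hx₀r]; push_cast; ring
    rw [Function.comp_apply, e, mul_div_assoc', Complex.div_ofReal_re]

/-- The constant of the geometric decay. -/
lemma decayConst_eq (hp : 0 < p) (hp1 : p < 1 / 2) {x₀ x₁ x₂ : ℂ} (hx₀ : x₀ = (p / (1 - p)) ^ 2)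
    (hx₁ : x₁ = decayRoot p (1 - p) (root p)) (hx₂ : x₂ = decayRoot p (1 - p) (rootConj p))
    {a t θ : ℝ} (ha : a = rootRe p) (ht : t = 1 - 2 * p) (hθ : θ = theta p) :
    ((1 - x₀) * (1 - x₁) * (1 - x₂) * (x₀ ^ 2 / ((x₀ - x₁) * (x₀ - x₂)))).re
      = t * p ^ 2 / (1 - p) ^ 4 * ((θ + t ^ 2 + 2 * t * a) / (θ + t ^ 2 - 2 * t * a)) := by
  have ha1 := one_lt_rootRe hp hp1
  have hP : (p : ℂ) ≠ 0 := Complex.ofReal_ne_zero.2 hp.ne'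
  have hQ : (1 - p : ℂ) ≠ 0 := by
    rw [← Complex.ofReal_one, ← Complex.ofReal_sub]
    exact Complex.ofReal_ne_zero.2 (by linarith)
  have h1 := (ne_zero_of_re_pos (s := root p) (by rw [root_re]; linarith)).2
  have h2 := (ne_zero_of_re_pos (s := rootConj p) (by rw [rootConj_re]; linarith)).2
  have hm := root_mul_rootConj hp hp1
  have hadd : root p + rootConj p = 2 * a := by rw [root, rootConj, ha]; ring
  rw [← hθ] at hm
  have htc : (t : ℂ) = 1 - 2 * p := by rw [ht]; push_cast; ring
  have d1 : root p - t ≠ 0 := by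
    refine (ne_zero_of_re_pos (s := root p - t) ?_).1
    rw [Complex.sub_re, root_re, Complex.ofReal_re]; linarith
  have d2 : rootConj p - t ≠ 0 := by
    refine (ne_zero_of_re_pos (s := rootConj p - t) ?_).1
    rw [Complex.sub_re, rootConj_re, Complex.ofReal_re]; linarith
  set s := root p
  set s' := rootConj p
  -- Here t = 1 − 2p is the square root for ω = 1. The factors 1 + s and 1 + s' cancel in the final
  -- quotient, leaving symmetric functions of s and s'.
  have f1 : 1 - x₁ = (s + t) / ((1 - p) * (1 + s)) := by
    rw [hx₁, decayRoot, htc]; field_simp; ring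
  have f2 : 1 - x₂ = (s' + t) / ((1 - p) * (1 + s')) := by
    rw [hx₂, decayRoot, htc]; field_simp; ring
  have g1 : x₀ - x₁ = p * (s - t) / ((1 - p) ^ 2 * (1 + s)) := by
    rw [hx₀, hx₁, decayRoot, htc]; field_simp; ring
  have g2 : x₀ - x₂ = p * (s' - t) / ((1 - p) ^ 2 * (1 + s')) := by
    rw [hx₀, hx₂, decayRoot, htc]; field_simp; ring
  have f0 : 1 - x₀ = t / (1 - p) ^ 2 := by
    rw [hx₀, htc]; field_simp; ring
  have hnum : (s + t) * (s' + t) = θ + t ^ 2 + 2 * t * a := by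
    linear_combination hm + t * hadd
  have hden : (s - t) * (s' - t) = θ + t ^ 2 - 2 * t * a := by
    linear_combination hm - t * hadd
  have hfin : (1 - x₀) * (1 - x₁) * (1 - x₂) * (x₀ ^ 2 / ((x₀ - x₁) * (x₀ - x₂)))
      = t * p ^ 2 / (1 - p) ^ 4 * (((s + t) * (s' + t)) / ((s - t) * (s' - t))) := by
    rw [f0, f1, f2, g1, g2, hx₀]
    field_simp
  rw [hfin, hnum, hden, ← Complex.ofReal_re
    (t * p ^ 2 / (1 - p) ^ 4 * ((θ + t ^ 2 + 2 * t * a) / (θ + t ^ 2 - 2 * t * a)))]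
  congr 1
  push_cast
  ring

end Stationary

/-! ### Algebra of the parameters x, t, θ, a, c. -/

section RootRelations

/-- The relations between the parameters, with `x = p q` and `t = q - p`. -/
structure RootRelations (p x t θ a c : ℝ) : Prop where
  x_eq : x = p * (1 - p)
  t_eq : t = 1 - 2 * p
  x_pos : 0 < x
  x_lt : x < 1 / 4
  t_pos : 0 < t
  one_lt_a : 1 < a
  c_pos : 0 < c
  c_lt : c < a
  θ_pos : 0 < θ
  θ_sq : θ ^ 2 = 1 + 4 * x + 16 * x ^ 2
  a_sq : 2 * a ^ 2 = θ + 1 + 2 * x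
  c_sq : 2 * c ^ 2 = 3 * (θ - 1 - 2 * x)
  a_mul_c : a * c = 3 * x
  a_mul_θ : a * θ = a * (1 + 2 * x) + 2 * x * c
  c_mul_θ : c * θ = 6 * x * a - (1 + 2 * x) * c

lemma rootRelations {p : ℝ} (hp : 0 < p) (hp1 : p < 1 / 2) :
    RootRelations p (p * (1 - p)) (1 - 2 * p) (theta p) (rootRe p) (rootIm p) := by
  have ha := one_lt_rootRe hp hp1
  have hx : 0 < p * (1 - p) := mul_pos hp (by linarith)
  have hx4 := prod_lt_quarter hp1
  have hac := rootRe_mul_rootIm hp hp1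
  have hθ := (theta_bounds hp hp1).1
  have hc : 0 < rootIm p := pos_of_mul_pos_right (by rw [hac]; linarith) (by linarith)
  have hasq := rootRe_sq hp hp1
  have haθ := rootIm_eq hp hp1
  refine ⟨rfl, rfl, hx, hx4, by linarith, ha, hc, ?_, by linarith, theta_sq hp (by linarith), hasq,
    rootIm_sq hp hp1, hac, by linear_combination -haθ, ?_⟩
  · nlinarith
  · refine mul_left_cancel₀ (show rootRe p ≠ 0 by linarith) ?_
    linear_combination (theta p + 1 + 2 * (p * (1 - p))) * hac - 3 * (p * (1 - p)) * hasq

variable {p x t θ a c : ℝ} (h : RootRelations p x t θ a c)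
include h

/-- The factor θ + 2at is 3tθG_0, the denominator shared by the hitting probabilities. Multiplying
by it and reducing to a combination of 1, θ, a, c makes the closed forms comparable coefficient by
coefficient. -/
lemma RootRelations.mul_numerator (α β m n : ℝ) :
    (α + β * θ + t * θ * (m * c + n * a)) * (θ + 2 * a * t) =
      α * θ + β * (1 + 4 * x + 16 * x ^ 2) + t * (1 + 4 * x + 16 * x ^ 2) * (m * c + n * a)
        + 2 * t * α * a + 2 * t * β * (a * (1 + 2 * x) + 2 * x * c)
        + t ^ 2 * (6 * x * m * θ + n * (1 + 4 * x + 16 * x ^ 2 + (1 + 2 * x) * θ)) := by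
  linear_combination (β + t * (m * c + n * a) + t ^ 2 * n) * h.θ_sq + 2 * t * β * h.a_mul_θ
    + 2 * t ^ 2 * θ * m * h.a_mul_c + t ^ 2 * θ * n * h.a_sq

end RootRelations

/-! ### Denesting the radicals. -/

section SquareRoots
variable {p x t a c : ℝ}

lemma sqrt_two_mul_sqrt {y R : ℝ} (hy : 0 ≤ y) (h : 2 * R = y ^ 2) : √2 * √R = y := by
  rw [← Real.sqrt_mul (by norm_num), h, Real.sqrt_sq hy]

lemma sqrt_eq_of_sq {y R : ℝ} (hy : 0 ≤ y) (h : R = y ^ 2) : √R = y := by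
  rw [h, Real.sqrt_sq hy]

variable (h : RootRelations p x t (theta p) a c)
include h

/-- Twice the radicand is the square of the right-hand side modulo the relations for θ² and a²;
positivity selects the sign. -/
lemma sqrt_bracket : √2 * √(vPoly p + uPoly p * theta p) = a * (theta p + (1 - 4 * x)) := by
  have := h.θ_pos
  have := h.x_lt
  have := h.one_lt_a
  refine sqrt_two_mul_sqrt (mul_nonneg (by linarith) (by linarith)) ?_
  have h1 := h.θ_sq
  have h2 := h.a_sq
  generalize theta p = θ at *
  rw [h.x_eq] at *
  simp only [vPoly, uPoly]
  linear_combination -((θ + (1 - 4 * (p * (1 - p)))) ^ 2 / 2) * h2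
    - (θ / 2 + (1 + 2 * (p * (1 - p))) / 2 + (1 - 4 * (p * (1 - p)))) * h1

lemma bracket_eq : bracket p = t * uPoly p + t ^ 3 * theta p
    + t ^ 2 * (a * (theta p + (1 - 4 * x))) := by
  rw [← sqrt_bracket h, bracket, h.t_eq]
  ring

lemma sqrt_hitRadicand0 : √2 * √(hitRadicand0 p) =
    2 * a * (1 + 4 * x + 16 * x ^ 2) + 8 * x * (1 - 4 * x) * c := by
  have hx := h.x_pos
  have hx4 : 0 < 1 - 4 * x := by linarith [h.x_lt]
  have ha := h.one_lt_a
  have hc := h.c_pos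
  refine sqrt_two_mul_sqrt (by positivity) ?_
  have h2 := h.a_sq
  have h3 := h.a_mul_c
  have h4 := h.c_sq
  obtain rfl := h.x_eq
  clear h
  simp only [hitRadicand0]
  generalize theta p = θ at *
  linear_combination -2 * (1 + 4 * (p * (1 - p)) + 16 * (p * (1 - p)) ^ 2) ^ 2 * h2
    - 32 * (1 + 4 * (p * (1 - p)) + 16 * (p * (1 - p)) ^ 2) * (p * (1 - p))
      * (1 - 4 * (p * (1 - p))) * h3
    - 32 * (p * (1 - p)) ^ 2 * (1 - 4 * (p * (1 - p))) ^ 2 * h4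

omit h in
/-- The square of a linear form in `a` and `c`. -/
lemma RootRelations.sq_linear {θ : ℝ} (h : RootRelations p x t θ a c) (m n : ℝ) :
    (m * c + n * a) ^ 2 = 3 / 2 * m ^ 2 * (θ - 1 - 2 * x) + 6 * m * n * x
      + n ^ 2 * (θ + 1 + 2 * x) / 2 := by
  linear_combination m ^ 2 / 2 * h.c_sq + 2 * m * n * h.a_mul_c + n ^ 2 / 2 * h.a_sq

-- Write the form as n(a − c) + (m + n)c. This fixes the sign of the denested radicals even when m
-- is negative.
omit h in
lemma linear_nonneg {m n : ℝ} (hc : 0 < c) (hca : c < a) (hn : 0 ≤ n) (hmn : 0 ≤ m + n) :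
    0 ≤ m * c + n * a := by
  nlinarith [mul_nonneg hn (sub_nonneg.2 hca.le), mul_nonneg hmn hc.le]

lemma sqrt_hitRadicand1 :
    √(hitRadicand1 p) = (1 - 32 * x ^ 2) * c + (1 + 32 * x ^ 2) * a := by
  refine sqrt_eq_of_sq (linear_nonneg h.c_pos h.c_lt (by positivity) (by linarith)) ?_
  rw [h.sq_linear]
  obtain rfl := h.x_eq
  simp only [hitRadicand1]
  ring

lemma sqrt_hitRadicand2 :
    √(hitRadicand2 p) = (-1 + 4 * x + 128 * x ^ 3) * c + (1 + 4 * x - 128 * x ^ 3) * a := by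
  have hx := h.x_pos
  have hx4 := h.x_lt
  have hx3 : x ^ 3 ≤ x / 16 := by nlinarith [mul_pos hx hx]
  refine sqrt_eq_of_sq (linear_nonneg h.c_pos h.c_lt (by linarith) (by linarith)) ?_
  rw [h.sq_linear]
  obtain rfl := h.x_eq
  simp only [hitRadicand2]
  ring

lemma sqrt_hitRadicand3 : √(hitRadicand3 p) =
    (8 * t * x * (1 - 4 * x) - 6 * x + 39 * x ^ 2 + 288 * x ^ 4) * c
      + (2 * t * (1 + 4 * x + 16 * x ^ 2) + 6 * x + 39 * x ^ 2 - 288 * x ^ 4) * a := by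
  have hx := h.x_pos
  have hx4 := h.x_lt
  have hx3 : x ^ 4 ≤ x ^ 2 / 16 := by
    nlinarith [mul_pos (mul_pos hx hx) (mul_pos (sub_pos.2 hx4) (by linarith : 0 < 1 / 4 + x))]
  have h1 : 0 ≤ 2 * t * (1 + 4 * x + 16 * x ^ 2) := by have := h.t_pos; positivity
  have h2 : 0 ≤ 8 * t * x * (1 - 4 * x) := by
    have := h.t_pos
    have : 0 < 1 - 4 * x := by linarith
    positivity
  refine sqrt_eq_of_sq (linear_nonneg h.c_pos h.c_lt (by nlinarith) (by nlinarith)) ?_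
  rw [h.sq_linear]
  obtain rfl := h.x_eq
  obtain rfl := h.t_eq
  simp only [hitRadicand3]
  ring

lemma two_mul_sqrt_chi3 :
    √2 * √(gammaPoly p + alphaPoly p * betaPoly p * theta p)
      = (uPoly p + (1 - 4 * x) * theta p) / 2 * (√2 * √(vPoly p + uPoly p * theta p)) := by
  have hx4 := h.x_lt
  have hθ := h.θ_pos
  have hu : 0 < uPoly p + (1 - 4 * x) * theta p := by
    have : uPoly p = 1 - 2 * x + 4 * x ^ 2 := by rw [uPoly, h.x_eq]; ring
    have : 0 < (1 - 4 * x) * theta p := mul_pos (by linarith) hθ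
    nlinarith
  have e : gammaPoly p + alphaPoly p * betaPoly p * theta p
      = ((uPoly p + (1 - 4 * x) * theta p) / 2) ^ 2 * (vPoly p + uPoly p * theta p) := by
    have h1 := h.θ_sq
    obtain rfl := h.x_eq
    clear h
    simp only [gammaPoly, alphaPoly, betaPoly, uPoly, vPoly] at *
    generalize theta p = θ at *
    linear_combination -(1 / 4) * ((1 - 4 * (p * (1 - p))) ^ 2
        * (1 - 2 * p + 6 * p ^ 2 - 8 * p ^ 3 + 4 * p ^ 4) * θ
      + (1 - 4 * (p * (1 - p))) ^ 2 * (1 + 6 * p ^ 2 - 28 * p ^ 3 + 54 * p ^ 4 - 48 * p ^ 5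
        + 16 * p ^ 6)
      + 2 * (1 - 2 * p + 6 * p ^ 2 - 8 * p ^ 3 + 4 * p ^ 4) ^ 2 * (1 - 4 * (p * (1 - p)))) * h1
  rw [e, Real.sqrt_mul (sq_nonneg _), Real.sqrt_sq (by linarith)]
  ring

lemma bracket_sq_eq : bracket p ^ 2 / (288 * p * (1 - p) ^ 9) = chi3 p / 6 := by
  have hs := two_mul_sqrt_chi3 h
  have hb : bracket p = (1 - p - p) * uPoly p + (1 - p - p) ^ 3 * theta p
      + (1 - p - p) ^ 2 * (√2 * √(vPoly p + uPoly p * theta p)) := by rw [bracket]; ring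
  have hc : chi3 p = (1 - p - p) ^ 2 / (12 * p * (1 - p) ^ 9) * (alphaPoly p
      + (1 - p - p) ^ 2 * betaPoly p * theta p
      + (1 - p - p) * (√2 * √(gammaPoly p + alphaPoly p * betaPoly p * theta p))) := by
    rw [chi3]; ring
  rw [hb, hc, hs, sqrt_bracket h]
  have h1 := h.θ_sq
  have h2 := h.a_sq
  obtain rfl := h.x_eq
  clear h hs hb hc
  have e : ((1 - p - p) * uPoly p + (1 - p - p) ^ 3 * theta p + (1 - p - p) ^ 2
      * (a * (theta p + (1 - 4 * (p * (1 - p)))))) ^ 2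
      = 4 * (1 - p - p) ^ 2 * (alphaPoly p + (1 - p - p) ^ 2 * betaPoly p * theta p + (1 - p - p)
      * ((uPoly p + (1 - 4 * (p * (1 - p))) * theta p) / 2
        * (a * (theta p + (1 - 4 * (p * (1 - p))))))) := by
    simp only [alphaPoly, betaPoly, uPoly]
    generalize theta p = θ at *
    linear_combination (1 - p - p) ^ 4 * (θ + (1 - 4 * (p * (1 - p)))) ^ 2 / 2 * h2
      + ((1 - p - p) ^ 4 * (θ + 1 + 2 * (p * (1 - p)) + 2 * (1 - 4 * (p * (1 - p)))) / 2
        + (1 - p - p) ^ 6) * h1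
  rw [e]
  generalize (1 - p) ^ 9 = y
  generalize alphaPoly p + (1 - p - p) ^ 2 * betaPoly p * theta p + (1 - p - p)
      * ((uPoly p + (1 - 4 * (p * (1 - p))) * theta p) / 2
        * (a * (theta p + (1 - 4 * (p * (1 - p)))))) = w
  ring

/-- Eliminates the quotient in the decay constant of π, and thereby identifies it with `tailConst`.
-/
lemma bracket_mul_one :
    bracket p * (theta p + t ^ 2 - 2 * t * a) = 12 * x ^ 2 * t * (theta p + t ^ 2 + 2 * t * a) := by
  rw [bracket_eq h]
  have h1 := h.θ_sq
  have h2 := h.a_sq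
  obtain rfl := h.x_eq
  obtain rfl := h.t_eq
  clear h
  simp only [uPoly]
  generalize theta p = θ at *
  linear_combination (1 - 2 * p) ^ 2 * a * h1
    - (1 - 2 * p) ^ 3 * (θ + (1 - 2 * p) ^ 2) * h2

/-- The counterpart for the clump rate, whose limit is a multiple of (a − c + t)/(a − c − t). -/
lemma bracket_mul_two : bracket p * (a - c - t) = 12 * x ^ 2 * t * (a - c + t) := by
  rw [bracket_eq h]
  have h2 := h.a_sq
  have h3 := h.a_mul_c
  have h4 := h.a_mul_θ
  have h5 := h.c_mul_θ
  have h6 := h.c_sq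
  have e : t ^ 2 = 1 - 4 * x := by rw [h.t_eq, h.x_eq]; ring
  have hu : uPoly p = 1 - 2 * x + 4 * x ^ 2 := by rw [uPoly, h.x_eq]; ring
  rw [show t ^ 3 = t * (1 - 4 * x) by rw [← e]; ring, hu]
  clear h
  generalize theta p = θ at *
  linear_combination t * ((1 - 4 * x) + t * (a - c - t)) * h4 - t * (1 - 4 * x) * h5
    + t ^ 2 * (1 - x) * h2 + t ^ 2 * (4 * x - 2) * h3 - t ^ 2 * x * h6
    - t * (a * (2 - 2 * x) + 2 * x * c) * e

end SquareRoots

/-! ### Closed forms of the hitting probabilities. -/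

section Numerators
variable {p x t a c : ℝ} (h : RootRelations p x t (theta p) a c)
include h

/-- The second factor on the right is the numerator of ν_0 = 1 − 1/G_0 over θ + 2at. The three
analogues below likewise contain the numerators of the Green values, so `hitDen` arises only from
rationalising. -/
lemma hitNum0_mul :
    hitNum0 p * (theta p + 2 * a * t) = hitDen p * (theta p + 2 * a * t - 3 * t * theta p) := by
  have e : hitNum0 p = (-2 * p * (-3 - 18 * p + 92 * p ^ 2 - 120 * p ^ 3 + 816 * p ^ 4
        - 2816 * p ^ 5 + 3840 * p ^ 6 - 2304 * p ^ 7 + 512 * p ^ 8))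
      + (2 * t ^ 3 * (1 + 4 * p + 12 * p ^ 2 - 32 * p ^ 3 + 16 * p ^ 4)) * theta p
      + t * theta p * ((-8 * t * x * (1 - 4 * x)) * c + (-2 * t * (1 + 4 * x + 16 * x ^ 2)) * a) := by
    have hs := sqrt_hitRadicand0 h
    rw [hitNum0, mul_assoc _ √2, hs, h.t_eq]
    ring
  rw [e, h.mul_numerator, hitDen]
  obtain rfl := h.x_eq
  obtain rfl := h.t_eq
  ring

lemma hitNum1_mul : hitNum1 p * (theta p + 2 * a * t)
    = hitDen p * (theta p + t * (c - a) - 2 * x * (theta p + 2 * a * t)) := by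
  have e : hitNum1 p = -6 * x
      + (-t ^ 2 * (1 + 32 * p ^ 2 - 64 * p ^ 3 + 32 * p ^ 4)) * theta p
      + t * theta p * ((1 - 32 * x ^ 2) * c + (1 + 32 * x ^ 2) * a) := by
    rw [hitNum1, sqrt_hitRadicand1 h, h.t_eq, h.x_eq]
    ring
  rw [e, h.mul_numerator, hitDen]
  obtain rfl := h.x_eq
  obtain rfl := h.t_eq
  ring

lemma hitNum2_mul : hitNum2 p * (theta p + 2 * a * t)
    = hitDen p * (theta p - t * (a + c) - 4 * x * (theta p + t * (c - a))
      + 2 * x ^ 2 * (theta p + 2 * a * t)) := by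
  have e : hitNum2 p
      = -6 * x ^ 2 * (5 - 256 * p ^ 3 + 768 * p ^ 4 - 768 * p ^ 5 + 256 * p ^ 6)
      + (-t ^ 4 * (1 + 8 * p + 24 * p ^ 2 - 64 * p ^ 3 + 32 * p ^ 4)) * theta p
      + t * theta p * ((-1 + 4 * x + 128 * x ^ 3) * c + (1 + 4 * x - 128 * x ^ 3) * a) := by
    rw [hitNum2, sqrt_hitRadicand2 h, h.t_eq, h.x_eq]
    ring
  rw [e, h.mul_numerator, hitDen]
  obtain rfl := h.x_eq
  obtain rfl := h.t_eq
  ring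

lemma hitNum3_mul : hitNum3 p * (theta p + 2 * a * t)
    = hitDen p * (theta p + 2 * a * t - 3 * t * theta p - 6 * x * (theta p - t * (a + c))
      + 9 * x ^ 2 * (theta p + t * (c - a)) - 2 * x ^ 3 * (theta p + 2 * a * t)) := by
  have e : hitNum3 p
      = (-2 * p * (-3 - 18 * p - 33 * p ^ 2 + 255 * p ^ 3 + 441 * p ^ 4 - 643 * p ^ 5
          - 8448 * p ^ 6 + 28416 * p ^ 7 - 40448 * p ^ 8 + 30720 * p ^ 9 - 12288 * p ^ 10
          + 2048 * p ^ 11))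
      + (-t ^ 2 * (-2 - 10 * p - 41 * p ^ 2 + 190 * p ^ 3 + 89 * p ^ 4 - 1088 * p ^ 5
          + 1728 * p ^ 6 - 1152 * p ^ 7 + 288 * p ^ 8)) * theta p
      + t * theta p * (-(8 * t * x * (1 - 4 * x) - 6 * x + 39 * x ^ 2 + 288 * x ^ 4) * c
        + -(2 * t * (1 + 4 * x + 16 * x ^ 2) + 6 * x + 39 * x ^ 2 - 288 * x ^ 4) * a) := by
    rw [hitNum3, sqrt_hitRadicand3 h, h.t_eq, h.x_eq]
    ring
  rw [e, h.mul_numerator, hitDen]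
  obtain rfl := h.x_eq
  obtain rfl := h.t_eq
  ring

end Numerators

section HittingProbabilities
variable {p : unitInterval}

/-- The hitting probabilities in terms of the tilted Green function. -/
lemma nu_greenTilt (hp : 0 < (p : ℝ)) (hp1 : (p : ℝ) < 1 / 2) :
    1 - nu p 0 = 1 / (greenTilt p 0).re ∧
    ∀ j ≠ 0, nu p j = ((p : ℝ) / (1 - p)) ^ j * (greenTilt p j).re / (greenTilt p 0).re := by
  have h := nu_of_green p (hasSum_stepsProb p hp hp1)
  simpa using h

lemma nu_closed_forms (hp : 0 < (p : ℝ)) (hp1 : (p : ℝ) < 1 / 2) (hΔ : hitDen p ≠ 0) :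
    nu p 0 = hitNum0 p / hitDen p ∧
    nu p (-1) = hitNum1 p / (2 * (p : ℝ) ^ 2 * hitDen p) ∧
    nu p (-2) = hitNum2 p / (2 * (p : ℝ) ^ 4 * hitDen p) ∧
    nu p (-3) = hitNum3 p / (2 * (p : ℝ) ^ 6 * hitDen p) ∧
    nu p 1 = hitNum1 p / (2 * hitDen p * (1 - p : ℝ) ^ 2) ∧
    nu p 2 = hitNum2 p / (2 * hitDen p * (1 - p : ℝ) ^ 4) := by
  have h := rootRelations hp hp1
  obtain ⟨g0, g1, g2, g3⟩ := greenTilt_values hp hp1 rfl rfl rfl rfl rfl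
  obtain ⟨h0, hν⟩ := nu_greenTilt hp hp1
  have hq : (1 - (p : ℝ)) ≠ 0 := by linarith
  have hp0 := hp.ne'
  have hn0 := hitNum0_mul h
  have hn1 := hitNum1_mul h
  have hn2 := hitNum2_mul h
  have hn3 := hitNum3_mul h
  have hx := h.x_pos.ne'
  have ht := h.t_pos.ne'
  have hθ := h.θ_pos.ne'
  have hF : theta p + 2 * rootRe p * (1 - 2 * p) ≠ 0 := by
    have := h.θ_pos
    have := h.t_pos
    have := h.one_lt_a
    positivity
  have hF' : (1 / (1 - 2 * (p : ℝ)) + 2 * rootRe p / theta p) / 3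
      = (theta p + 2 * rootRe p * (1 - 2 * p)) / (3 * (1 - 2 * p) * theta p) := by
    field_simp
  rw [hF'] at g0
  have hm1 := hν (-1) (by norm_num)
  have hm2 := hν (-2) (by norm_num)
  have hm3 := hν (-3) (by norm_num)
  have hp1' := hν 1 (by norm_num)
  have hp2 := hν 2 (by norm_num)
  rw [greenTilt_neg, zpow_neg] at hm1 hm2 hm3
  rw [g0, g1] at hm1 hp1'
  rw [g0, g2] at hm2 hp2
  rw [g0, g3] at hm3
  rw [g0] at h0
  have eN0 : hitNum0 p = hitDen p * (theta p + 2 * rootRe p * (1 - 2 * p)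
      - 3 * (1 - 2 * p) * theta p) / (theta p + 2 * rootRe p * (1 - 2 * p)) := by
    rw [eq_div_iff hF, hn0]
  have eN1 := (eq_div_iff hF).2 hn1
  have eN2 := (eq_div_iff hF).2 hn2
  have eN3 := (eq_div_iff hF).2 hn3
  generalize theta p = θ at *
  generalize rootRe p = a at *
  generalize rootIm p = c at *
  generalize ht' : 1 - 2 * (p : ℝ) = t at *
  rw [show (1 : ℤ) = ((1 : ℕ) : ℤ) from rfl, zpow_natCast] at hm1 hp1'
  rw [show (2 : ℤ) = ((2 : ℕ) : ℤ) from rfl, zpow_natCast] at hm2 hp2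
  rw [show (3 : ℤ) = ((3 : ℕ) : ℤ) from rfl, zpow_natCast] at hm3
  norm_num at hm1 hm2 hm3 hp1' hp2
  refine ⟨?_, ?_, ?_, ?_, ?_, ?_⟩
  · rw [show nu p 0 = 1 - (1 - nu p 0) by ring, h0, eN0]
    field_simp
  · rw [hm1, eN1]
    field_simp
  · rw [hm2, eN2]
    field_simp
    ring
  · rw [hm3, eN3]
    field_simp
    ring
  · rw [hp1', eN1]
    field_simp
  · rw [hp2, eN2]
    field_simp
    ring

end HittingProbabilities

/-! ### Clump rates. -/

section Toeplitz

/-- Solution of a tilted symmetric `3 × 3` Toeplitz system. -/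
lemma toeplitz_iff {g₀ g₁ g₂ r b₀ b₁ b₂ : ℝ} (hr : r ≠ 0) (hS : g₀ - g₂ ≠ 0)
    (hD : g₀ * (g₀ + g₂) - 2 * g₁ ^ 2 ≠ 0) (l : Fin 3 → ℝ) :
    (g₀ * l 0 + g₁ / r * l 1 + g₂ / r ^ 2 * l 2 = b₀ ∧
      g₁ * r * l 0 + g₀ * l 1 + g₁ / r * l 2 = b₁ ∧
      g₂ * r ^ 2 * l 0 + g₁ * r * l 1 + g₀ * l 2 = b₂) ↔
    l = ![((g₀ * (b₀ + b₂ / r ^ 2) - 2 * g₁ * (b₁ / r)) / (g₀ * (g₀ + g₂) - 2 * g₁ ^ 2)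
          + (b₀ - b₂ / r ^ 2) / (g₀ - g₂)) / 2,
        r * (((g₀ + g₂) * (b₁ / r) - g₁ * (b₀ + b₂ / r ^ 2)) / (g₀ * (g₀ + g₂) - 2 * g₁ ^ 2)),
        r ^ 2 * ((g₀ * (b₀ + b₂ / r ^ 2) - 2 * g₁ * (b₁ / r)) / (g₀ * (g₀ + g₂) - 2 * g₁ ^ 2)
          - (b₀ - b₂ / r ^ 2) / (g₀ - g₂)) / 2] := by
  constructor
  · rintro ⟨e0, e1, e2⟩
    -- Once the tilt by powers of r is removed, the matrix commutes with reversal. The system splits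
    -- into a 2 × 2 even block and a scalar odd block, with determinants g₀(g₀ + g₂) − 2g₁² and g₀ −
    -- g₂.
    have f0 : b₀ + b₂ / r ^ 2 = (g₀ + g₂) * (l 0 + l 2 / r ^ 2) + 2 * g₁ * (l 1 / r) := by
      rw [← e0, ← e2]; field_simp; ring
    have f1 : b₁ / r = g₁ * (l 0 + l 2 / r ^ 2) + g₀ * (l 1 / r) := by
      rw [← e1]; field_simp; ring
    have f2 : b₀ - b₂ / r ^ 2 = (g₀ - g₂) * (l 0 - l 2 / r ^ 2) := by
      rw [← e0, ← e2]; field_simp; ring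
    have k0 : (g₀ * (b₀ + b₂ / r ^ 2) - 2 * g₁ * (b₁ / r)) / (g₀ * (g₀ + g₂) - 2 * g₁ ^ 2)
        = l 0 + l 2 / r ^ 2 := by
      rw [div_eq_iff hD, f0, f1]; ring
    have k1 : ((g₀ + g₂) * (b₁ / r) - g₁ * (b₀ + b₂ / r ^ 2)) / (g₀ * (g₀ + g₂) - 2 * g₁ ^ 2)
        = l 1 / r := by
      rw [div_eq_iff hD, f0, f1]; ring
    have k2 : (b₀ - b₂ / r ^ 2) / (g₀ - g₂) = l 0 - l 2 / r ^ 2 := by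
      rw [div_eq_iff hS, f2]; ring
    rw [k0, k1, k2]
    ext i
    fin_cases i
    · simp
    · simp; field_simp
    · simp; field_simp; ring
  · rintro rfl
    simp only [Matrix.cons_val]
    have e : ∀ A B C E D : ℝ, A * (B / D) + C * (E / D) = (A * B + C * E) / D := by intros; ring
    have k0 : (g₀ + g₂) * ((g₀ * (b₀ + b₂ / r ^ 2) - 2 * g₁ * (b₁ / r)) /
          (g₀ * (g₀ + g₂) - 2 * g₁ ^ 2))
        + 2 * g₁ * (((g₀ + g₂) * (b₁ / r) - g₁ * (b₀ + b₂ / r ^ 2)) /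
          (g₀ * (g₀ + g₂) - 2 * g₁ ^ 2)) = b₀ + b₂ / r ^ 2 := by
      rw [e, div_eq_iff hD]
      ring
    have k1 : g₁ * ((g₀ * (b₀ + b₂ / r ^ 2) - 2 * g₁ * (b₁ / r)) /
          (g₀ * (g₀ + g₂) - 2 * g₁ ^ 2))
        + g₀ * (((g₀ + g₂) * (b₁ / r) - g₁ * (b₀ + b₂ / r ^ 2)) /
          (g₀ * (g₀ + g₂) - 2 * g₁ ^ 2)) = b₁ / r := by
      rw [e, div_eq_iff hD]
      ring
    have k2 : (g₀ - g₂) * ((b₀ - b₂ / r ^ 2) / (g₀ - g₂)) = b₀ - b₂ / r ^ 2 :=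
      mul_div_cancel₀ _ hS
    generalize (g₀ * (b₀ + b₂ / r ^ 2) - 2 * g₁ * (b₁ / r)) /
      (g₀ * (g₀ + g₂) - 2 * g₁ ^ 2) = σ at *
    generalize ((g₀ + g₂) * (b₁ / r) - g₁ * (b₀ + b₂ / r ^ 2)) /
      (g₀ * (g₀ + g₂) - 2 * g₁ ^ 2) = m at *
    generalize (b₀ - b₂ / r ^ 2) / (g₀ - g₂) = δ at *
    have k3 : g₀ * (σ + δ) + 2 * g₁ * m + g₂ * (σ - δ) = 2 * b₀ := by
      linear_combination k0 + k2
    field_simp at k0 k1 k2 ⊢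
    refine ⟨?_, ?_, ?_⟩
    · linear_combination k3
    · linear_combination 2 * k1
    · linear_combination k0 - k2

end Toeplitz

section Clumps
variable {p : unitInterval}

/-- The clump rates solve a Toeplitz system built from the tilted Green function. -/
lemma isClumpRates_iff (hp : 0 < (p : ℝ)) (hp1 : (p : ℝ) < 1 / 2) {g₀ g₁ g₂ r : ℝ}
    (hg₀ : (greenTilt p 0).re = g₀) (hg₁ : (greenTilt p 1).re = g₁)
    (hg₂ : (greenTilt p 2).re = g₂) (hr : r = p / (1 - p)) (h0 : g₀ ≠ 0)
    (π : ℕ → ℝ) (j : ℕ) (l : Fin 3 → ℝ) :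
    IsClumpRates p π j l ↔
      (g₀ * l 0 + g₁ / r * l 1 + g₂ / r ^ 2 * l 2 = π j ∧
      g₁ * r * l 0 + g₀ * l 1 + g₁ / r * l 2 = π (j + 1) ∧
      g₂ * r ^ 2 * l 0 + g₁ * r * l 1 + g₀ * l 2 = π (j + 2)) := by
  obtain ⟨hν0, hν⟩ := nu_greenTilt hp hp1
  have hm1 := hν (-1) (by norm_num)
  have hm2 := hν (-2) (by norm_num)
  have hp1' := hν 1 (by norm_num)
  have hp2 := hν 2 (by norm_num)
  have hr0 : r ≠ 0 := by rw [hr]; exact div_ne_zero hp.ne' (by linarith)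
  rw [greenTilt_neg, zpow_neg, ← hr, hg₀, hg₁, zpow_one] at hm1
  rw [greenTilt_neg, zpow_neg, ← hr, hg₀, hg₂, show (2 : ℤ) = ((2 : ℕ) : ℤ) from rfl,
    zpow_natCast] at hm2
  rw [← hr, hg₀, hg₁, zpow_one] at hp1'
  rw [← hr, hg₀, hg₂, show (2 : ℤ) = ((2 : ℕ) : ℤ) from rfl, zpow_natCast] at hp2
  push_cast at hm2 hp2
  rw [hg₀] at hν0
  -- Each equation is multiplied by G_0 = 1/(1 − ν_0).
  rw [IsClumpRates, hν0, hm1, hm2, hp1', hp2]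
  refine and_congr ?_ (and_congr ?_ ?_) <;>
    · constructor <;> intro h <;> field_simp at h ⊢ <;> linear_combination h

/-- The entries and the determinant of the Toeplitz system in closed form. -/
lemma green_constants {p x t θ a c : ℝ} (h : RootRelations p x t θ a c) {g₀ g₁ g₂ : ℝ}
    (hg₀ : g₀ = (1 / t + 2 * a / θ) / 3)
    (hg₁ : g₁ = ((1 / t + (c - a) / θ) / (2 * x) - (1 / t + 2 * a / θ)) / 3)
    (hg₂ : g₂ = ((1 / t - (a + c) / θ) / (2 * x ^ 2) - 2 * (1 / t + (c - a) / θ) / x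
      + (1 / t + 2 * a / θ)) / 3) :
    0 < a - c - t ∧ g₀ - g₂ = (a - c - t) / (6 * x ^ 2) ∧
    g₀ * (g₀ + g₂) - 2 * g₁ ^ 2 = (a - c - t) / (6 * x ^ 2 * t * θ) ∧
    t * θ * ((1 - 2 * x) ^ 2 * g₀ / 2 - 2 * x * (1 - 2 * x) * g₁ + x ^ 2 * (g₀ + g₂)) + t ^ 2 / 2
      = t * (a - c + t) / 2 := by
  have hx := h.x_pos
  have ht := h.t_pos
  have hθ := h.θ_pos
  have ht2 : t ^ 2 = 1 - 4 * x := by rw [h.t_eq, h.x_eq]; ring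
  refine ⟨?_, ?_, ?_, ?_⟩
  · rw [sub_pos]
    refine lt_of_pow_lt_pow_left₀ 2 (sub_nonneg.2 h.c_lt.le) ?_
    -- The excess over t² is positive, so a − c > t and both determinants are nonzero.
    have e : (a - c) ^ 2 = t ^ 2 + 4 / 3 * c ^ 2 := by
      linear_combination h.a_sq / 2 - 2 * h.a_mul_c - h.c_sq / 6 - ht2
    have := h.c_pos
    rw [e]
    have : 0 < c ^ 2 := by positivity
    linarith
  · rw [hg₀, hg₂]
    field_simp
    linear_combination -6 * t * h.a_mul_θ + 6 * t * h.c_mul_θ + 6 * θ * ht2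
  · have e0 : g₀ = (θ + 2 * a * t) / (3 * t * θ) := by rw [hg₀]; field_simp
    have e1 : g₁ = (θ + t * (c - a) - 2 * x * (θ + 2 * a * t)) / (6 * x * t * θ) := by
      rw [hg₁]; field_simp; ring
    have e2 : g₂ = (θ - t * (a + c) - 4 * x * (θ + t * (c - a)) + 2 * x ^ 2 * (θ + 2 * a * t))
        / (6 * x ^ 2 * t * θ) := by
      rw [hg₂]; field_simp; ring
    rw [e0, e1, e2]
    field_simp
    linear_combination -27 * t ^ 2 * h.a_sq - 9 * t ^ 2 * h.c_sq
  · rw [hg₀, hg₁, hg₂]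
    field_simp
    ring

/-- The clump rates exist, are unique, and their sum is asymptotic to a multiple of `π`. -/
lemma clumpRate_asymptotics (hp : 0 < (p : ℝ)) (hp1 : (p : ℝ) < 1 / 2) {π : ℕ → ℝ} {A : ℝ}
    (hA : A ≠ 0)
    (hπ : Tendsto (fun j => π j / (((p : ℝ) / (1 - p)) ^ 2) ^ j) atTop (𝓝 A)) :
    (∀ j, ∃! l : Fin 3 → ℝ, IsClumpRates p π j l) ∧
    ∀ l : ℕ → Fin 3 → ℝ, (∀ j, IsClumpRates p π j (l j)) →
      Tendsto (fun j => clumpRate (l j) / π j) atTop (𝓝 (bracket p / (4 * (1 - p : ℝ) ^ 4))) := by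
  have h := rootRelations hp hp1
  have hb := bracket_mul_two h
  obtain ⟨hg0, hg1, hg2, -⟩ := greenTilt_values hp hp1 rfl rfl rfl rfl rfl
  obtain ⟨hpos, hS, hD, hnum⟩ := green_constants h hg0 hg1 hg2
  have hq : 0 < 1 - (p : ℝ) := by linarith
  have hx := h.x_pos
  have ht := h.t_pos
  have hθ := h.θ_pos
  have ha := h.one_lt_a
  obtain ⟨r, hr⟩ : ∃ r, r = (p : ℝ) / (1 - p) := ⟨_, rfl⟩
  have hr0 : r ≠ 0 := by rw [hr]; exact div_ne_zero hp.ne' hq.ne'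
  have hS0 : (greenTilt p 0).re - (greenTilt p 2).re ≠ 0 := by rw [hS]; positivity
  have hD0 : (greenTilt p 0).re * ((greenTilt p 0).re + (greenTilt p 2).re)
      - 2 * (greenTilt p 1).re ^ 2 ≠ 0 := by rw [hD]; positivity
  have h00 : (greenTilt p 0).re ≠ 0 := by rw [hg0]; positivity
  have key : ∀ j l, IsClumpRates p π j l ↔ _ := fun j l =>
    (isClumpRates_iff hp hp1 rfl rfl rfl hr h00 π j l).trans (toeplitz_iff hr0 hS0 hD0 l)
  refine ⟨fun j => ⟨_, (key j _).2 rfl, fun l hl => (key j l).1 hl⟩, fun l hl => ?_⟩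
  have hπ0 : ∀ᶠ j in atTop, π j ≠ 0 := by
    filter_upwards [hπ.eventually_ne hA] with j hj h0
    rw [h0, zero_div] at hj
    exact hj rfl
  rw [← hr] at hπ
  -- Only the geometric tail of π enters the limit; the total rate is linear in π j, π (j+1), π
  -- (j+2).
  have hstep : ∀ i : ℕ, Tendsto (fun j => π (j + i) / π j) atTop (𝓝 ((r ^ 2) ^ i)) := by
    intro i
    have h1 := (((tendsto_add_atTop_iff_nat i).2 hπ).div hπ hA).const_mul ((r ^ 2) ^ i)
    rw [div_self hA, mul_one] at h1
    refine h1.congr fun j => ?_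
    have := pow_ne_zero j (pow_ne_zero 2 hr0)
    simp only [Pi.div_apply, pow_add]
    field_simp
  have h1 := hstep 1
  have h2 := hstep 2
  rw [pow_one] at h1
  simp only [hD, hS] at key
  have hrate : ∀ b₀ b₁ b₂ : ℝ, ∀ g₀ g₁ g₂ D S : ℝ, clumpRate
      ![((g₀ * (b₀ + b₂ / r ^ 2) - 2 * g₁ * (b₁ / r)) / D + (b₀ - b₂ / r ^ 2) / S) / 2,
        r * (((g₀ + g₂) * (b₁ / r) - g₁ * (b₀ + b₂ / r ^ 2)) / D),
        r ^ 2 * ((g₀ * (b₀ + b₂ / r ^ 2) - 2 * g₁ * (b₁ / r)) / D - (b₀ - b₂ / r ^ 2) / S) / 2]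
      = b₀ * (((1 + r ^ 2) * g₀ / 2 - r * g₁) / D + (1 - r ^ 2) / 2 / S)
        + b₁ * ((r * (g₀ + g₂) - (1 + r ^ 2) * g₁) / r / D)
        + b₂ * (((1 + r ^ 2) * g₀ / 2 - r * g₁) / r ^ 2 / D - (1 - r ^ 2) / 2 / r ^ 2 / S) := by
    intros
    simp only [clumpRate, Matrix.cons_val]
    ring
  have hl' : ∀ j, clumpRate (l j) = _ := fun j =>
    (congrArg clumpRate ((key j (l j)).1 (hl j))).trans (hrate _ _ _ _ _ _ _ _)
  generalize (greenTilt p 0).re = g₀ at *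
  generalize (greenTilt p 1).re = g₁ at *
  generalize (greenTilt p 2).re = g₂ at *
  obtain ⟨D, hDdef⟩ : ∃ D, D = (rootRe p - rootIm p - (1 - 2 * p)) /
    (6 * ((p : ℝ) * (1 - p)) ^ 2 * (1 - 2 * p) * theta p) := ⟨_, rfl⟩
  obtain ⟨S, hSdef⟩ : ∃ S, S = (rootRe p - rootIm p - (1 - 2 * p)) /
    (6 * ((p : ℝ) * (1 - p)) ^ 2) := ⟨_, rfl⟩
  rw [← hDdef, ← hSdef] at hl'
  have hlim := ((tendsto_const_nhds
    (x := ((1 + r ^ 2) * g₀ / 2 - r * g₁) / D + (1 - r ^ 2) / 2 / S)).add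
    (h1.mul_const ((r * (g₀ + g₂) - (1 + r ^ 2) * g₁) / r / D))).add
    (h2.mul_const (((1 + r ^ 2) * g₀ / 2 - r * g₁) / r ^ 2 / D - (1 - r ^ 2) / 2 / r ^ 2 / S))
  have hval : bracket p / (4 * (1 - p : ℝ) ^ 4) = ((1 + r ^ 2) * g₀ / 2 - r * g₁) / D
      + (1 - r ^ 2) / 2 / S + r ^ 2 * ((r * (g₀ + g₂) - (1 + r ^ 2) * g₁) / r / D)
      + (r ^ 2) ^ 2 * (((1 + r ^ 2) * g₀ / 2 - r * g₁) / r ^ 2 / D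
        - (1 - r ^ 2) / 2 / r ^ 2 / S) := by
    have e1 : 1 + r ^ 2 = (1 - 2 * (p * (1 - p) : ℝ)) / (1 - p : ℝ) ^ 2 := by
      rw [hr]; field_simp; ring
    have e2 : 1 - r ^ 2 = (1 - 2 * p : ℝ) / (1 - p : ℝ) ^ 2 := by rw [hr]; field_simp; ring
    have e3 : r = (p * (1 - p) : ℝ) / (1 - p : ℝ) ^ 2 := by rw [hr]; field_simp
    have e4 : ((1 + r ^ 2) * g₀ / 2 - r * g₁) / D
        + (1 - r ^ 2) / 2 / S + r ^ 2 * ((r * (g₀ + g₂) - (1 + r ^ 2) * g₁) / r / D)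
        + (r ^ 2) ^ 2 * (((1 + r ^ 2) * g₀ / 2 - r * g₁) / r ^ 2 / D
        - (1 - r ^ 2) / 2 / r ^ 2 / S)
        = ((1 + r ^ 2) ^ 2 * g₀ / 2 - 2 * r * (1 + r ^ 2) * g₁ + r ^ 2 * (g₀ + g₂)) / D
        + (1 - r ^ 2) ^ 2 / 2 / S := by
      field_simp
      ring
    have hDS : D = S / ((1 - 2 * p : ℝ) * theta p) := by
      rw [hDdef, hSdef]
      field_simp
    have hS1 : S ≠ 0 := by rw [hSdef]; positivity
    have e5 : (1 + r ^ 2) ^ 2 * g₀ / 2 - 2 * r * (1 + r ^ 2) * g₁ + r ^ 2 * (g₀ + g₂)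
        = ((1 - 2 * (p * (1 - p) : ℝ)) ^ 2 * g₀ / 2
          - 2 * (p * (1 - p) : ℝ) * (1 - 2 * (p * (1 - p) : ℝ)) * g₁
          + (p * (1 - p) : ℝ) ^ 2 * (g₀ + g₂)) / (1 - p : ℝ) ^ 4 := by
      rw [e1, e3]
      generalize (1 - p : ℝ) = y
      ring
    rw [e4, e5, e2, hDS]
    generalize (1 - 2 * (p * (1 - p) : ℝ)) ^ 2 * g₀ / 2
          - 2 * (p * (1 - p) : ℝ) * (1 - 2 * (p * (1 - p) : ℝ)) * g₁
          + (p * (1 - p) : ℝ) ^ 2 * (g₀ + g₂) = w at *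
    have e6 : w / (1 - p : ℝ) ^ 4 / (S / ((1 - 2 * p : ℝ) * theta p))
        + ((1 - 2 * p : ℝ) / (1 - p : ℝ) ^ 2) ^ 2 / 2 / S
        = ((1 - 2 * p : ℝ) * theta p * w + (1 - 2 * p : ℝ) ^ 2 / 2) / S / (1 - p : ℝ) ^ 4 := by
      field_simp
    rw [e6, hnum, hSdef]
    generalize bracket p = B at *
    generalize rootRe p = a at *
    generalize rootIm p = c at *
    generalize (1 - 2 * p : ℝ) = t at *
    have := hpos.ne'
    field_simp
    linear_combination 2 * hb
  rw [hval]
  refine hlim.congr' ?_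
  filter_upwards [hπ0] with j hj
  rw [hl' j]
  field_simp

end Clumps

/-! ### Identification of the constants and conclusion. -/

lemma bracket_pos {p : ℝ} (hp : 0 < p) (hp1 : p < 1 / 2) : 0 < bracket p := by
  have h := rootRelations hp hp1
  have hx4 : 0 < 1 - 4 * (p * (1 - p)) := by linarith [h.x_lt]
  have := h.t_pos
  have := h.θ_pos
  have := h.one_lt_a
  have hu : 0 < uPoly p := by
    rw [show uPoly p = (1 - p * (1 - p)) ^ 2 + 3 * (p * (1 - p)) ^ 2 by rw [uPoly]; ring]
    have := h.x_pos
    positivity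
  rw [bracket_eq h]
  positivity

lemma tailConst_eq {p : ℝ} (hp : 0 < p) (hp1 : p < 1 / 2) {t θ a : ℝ} (ha : a = rootRe p)
    (ht : t = 1 - 2 * p) (hθ : θ = theta p) :
    t * p ^ 2 / (1 - p) ^ 4 * ((θ + t ^ 2 + 2 * t * a) / (θ + t ^ 2 - 2 * t * a))
      = tailConst p := by
  have h := rootRelations hp hp1
  have hb := bracket_mul_one h
  have hq : 0 < 1 - p := by linarith
  have hden : 0 < theta p + (1 - 2 * p) ^ 2 - 2 * (1 - 2 * p) * rootRe p := by
    have h1 : 0 < theta p + (1 - 2 * p) ^ 2 + 2 * (1 - 2 * p) * rootRe p := by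
      have := h.t_pos
      have := h.θ_pos
      have := h.one_lt_a
      positivity
    -- By `bracket_mul_one` this quantity is the bracket times the denominator, so the denominator
    -- inherits positivity from the bracket.
    have h2 : 0 < 12 * (p * (1 - p)) ^ 2 * (1 - 2 * p)
        * (theta p + (1 - 2 * p) ^ 2 + 2 * (1 - 2 * p) * rootRe p) := by
      have := h.t_pos
      have := h.x_pos
      positivity
    rw [← hb] at h2
    exact pos_of_mul_pos_right h2 (bracket_pos hp hp1).le
  rw [tailConst, ha, ht, hθ, mul_div_assoc', div_eq_div_iff hden.ne' (by positivity),
    hb]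
  field_simp

end TrafficLight

open TrafficLight in
theorem mainTheorem4 (p : unitInterval) (q : ℝ) (hq : q = 1 - (p : ℝ))
    (hp : 0 < (p : ℝ)) (hpq : (p : ℝ) < q) :
    -- closed forms of the hitting probabilities
    (TrafficLight.hitDen p ≠ 0 →
      TrafficLight.nu p 0 = TrafficLight.hitNum0 p / TrafficLight.hitDen p ∧
      TrafficLight.nu p (-1)
        = TrafficLight.hitNum1 p / (2 * (p : ℝ) ^ 2 * TrafficLight.hitDen p) ∧
      TrafficLight.nu p (-2)
        = TrafficLight.hitNum2 p / (2 * (p : ℝ) ^ 4 * TrafficLight.hitDen p) ∧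
      TrafficLight.nu p (-3)
        = TrafficLight.hitNum3 p / (2 * (p : ℝ) ^ 6 * TrafficLight.hitDen p) ∧
      TrafficLight.nu p 1 = TrafficLight.hitNum1 p / (2 * TrafficLight.hitDen p * q ^ 2) ∧
      TrafficLight.nu p 2 = TrafficLight.hitNum2 p / (2 * TrafficLight.hitDen p * q ^ 4)) ∧
    -- the stationary distribution exists, is unique, and has the following properties
    (∃ π : ℕ → ℝ, TrafficLight.IsStationary p π ∧
      (∀ π' : ℕ → ℝ, TrafficLight.IsStationary p π' → π' = π) ∧
      Asymptotics.IsEquivalent Filter.atTop π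
        (fun j => TrafficLight.tailConst p * ((p : ℝ) ^ 2 / q ^ 2) ^ j) ∧
      -- the clump rates are well defined
      (∀ j, ∃! l : Fin 3 → ℝ, TrafficLight.IsClumpRates p π j l) ∧
      ∀ l : ℕ → Fin 3 → ℝ, (∀ j, TrafficLight.IsClumpRates p π j (l j)) →
        -- asymptotic value of the clump rate
        Asymptotics.IsEquivalent Filter.atTop (fun j => TrafficLight.clumpRate (l j))
          (fun j => TrafficLight.bracket p / (4 * q ^ 4) * π j) ∧
        -- the hidden relation
        Filter.Tendsto (fun j => TrafficLight.clumpRate (l j) / π j) Filter.atTop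
          (nhds (3 * q ^ 2 * TrafficLight.tailConst p)) ∧
        -- the exponential coefficient
        Filter.Tendsto
          (fun j => 1 / 6 * ((p : ℝ) ^ 2 / q ^ 2) * (q ^ 3 / (p : ℝ) ^ 3)
            * (TrafficLight.clumpRate (l j) / π j) * TrafficLight.tailConst p)
          Filter.atTop (nhds (TrafficLight.bracket p ^ 2 / (288 * (p : ℝ) * q ^ 9)))) ∧
    TrafficLight.bracket p ^ 2 / (288 * (p : ℝ) * q ^ 9) = TrafficLight.chi3 p / 6 := by
  have hp1 : (p : ℝ) < 1 / 2 := by linarith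
  have h := rootRelations hp hp1
  have hq0 : 0 < q := by linarith
  have hB := bracket_pos hp hp1
  have hA : tailConst p ≠ 0 := by
    rw [tailConst, ← hq]
    positivity
  obtain ⟨π, hπ, huniq, hlim⟩ := exists_stationary hp hp1 rfl rfl rfl
  rw [decayConst_eq hp hp1 rfl rfl rfl rfl rfl rfl, tailConst_eq hp hp1 rfl rfl rfl] at hlim
  obtain ⟨hex, hrate⟩ := clumpRate_asymptotics hp hp1 hA hlim
  rw [← hq] at hlim hrate
  have hsq : bracket p ^ 2 / (288 * (p : ℝ) * q ^ 9) = chi3 p / 6 := by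
    rw [hq]; exact bracket_sq_eq h
  refine ⟨fun hΔ => ?_, ⟨π, hπ, huniq, ?_, hex, fun l hl => ⟨?_, ?_, ?_⟩⟩, hsq⟩
  · rw [hq]
    exact nu_closed_forms hp hp1 hΔ
  · refine Asymptotics.isEquivalent_of_tendsto_one ?_
    have h1 := hlim.div_const (tailConst p)
    rw [div_self hA] at h1
    refine h1.congr fun j => ?_
    rw [Pi.div_apply, div_div, div_pow, mul_comm]
  · refine Asymptotics.isEquivalent_of_tendsto_one ?_
    have h1 := (hrate l hl).div_const (bracket p / (4 * q ^ 4))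
    rw [div_self (by positivity)] at h1
    refine h1.congr fun j => ?_
    rw [Pi.div_apply, div_div, mul_comm]
  -- Both constants now carry the same bracket, so the hidden relation is 3q² · B/(12q⁶) = B/(4q⁴).
  · have e : 3 * q ^ 2 * tailConst p = bracket p / (4 * q ^ 4) := by
      rw [tailConst, ← hq]; field_simp; norm_num
    rw [e]
    exact hrate l hl
  · have e : bracket p ^ 2 / (288 * (p : ℝ) * q ^ 9) = 1 / 6 * ((p : ℝ) ^ 2 / q ^ 2)
        * (q ^ 3 / (p : ℝ) ^ 3) * (bracket p / (4 * q ^ 4)) * tailConst p := by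
      rw [tailConst, ← hq]; field_simp; norm_num
    rw [e]
    exact ((hrate l hl).const_mul _).mul_const _
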